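/- Let $n\ge 0$. Let $g$ be the Fubini-Study metric on $\mathbb{C}P^n$, with complex structure $j$, and let $\omega_{FS}=g(j\,\cdot,\cdot)$ be the Fubini-Study form, both normalized such that complex projective lines have area $4\pi$, i.e. the pullback of $g$ to $\mathbb{C}^{n+1}\setminus\{0\}$ is $4\,\mathrm{Re}\big(\langle\xi,\eta\rangle/|z|^2-\langle\xi,z\rangle\langle z,\eta\rangle/|z|^4\big)$. Equip $\mathbb{R}P^n\subset\mathbb{C}P^n$ with the induced round metric, also denoted $g$ (its prime geodesics have length $2\pi$). Let $\lambda_{(x,v)}=g_x(v,\mathrm{d}\pi\,\cdot)$ be the canonical one-form on $\pi:T\mathbb{R}P^n\to\mathbb{R}P^n$, let $D_1\mathbb{R}P^n=\{(x,v)\in T\mathbb{R}P^n : |v|_x<1\}$, and let $$Q^{n-1}=\{[z_0:\dots:z_n] : z_0^2+\dots+z_n^2=0\}\subset\mathbb{C}P^n .$$ Then there is an $SO(n+1)$-equivariant symplectomorphism $$F:(D_1\mathbb{R}P^n,\mathrm{d}\lambda)\to(\mathbb{C}P^n\setminus Q^{n-1},\omega_{FS}),$$ that is, a smooth diffeomorphism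 with $F^*\omega_{FS}=\mathrm{d}\lambda$ and $F(A\cdot(x,v))=A\cdot F(x,v)$ for all $A\in SO(n+1)$, where $SO(n+1)$ acts linearly on $\mathbb{C}P^n$ and by differentials of its linear action on $T\mathbb{R}P^n$. Moreover, $F$ can be given explicitly: if $u,w\in\mathbb{R}^{n+1}$ are orthonormal, $0\le r<1$, and $(x,v)$ is the image of $(u,\tfrac r2 w)$ under the differential of $\mathbb{R}^{n+1}\setminus\{0\}\to\mathbb{R}P^n$, $z\mapsto[z]$ (so that $|v|=r$), then $$F(x,v)=\big[\cos(f(r)\,r)\,u-i\sin(f(r)\,r)\,w\big],\qquad f(r)=\frac{\arcsin r}{2r},\quad f(r)\,r=\tfrac12\arcsin r .$$ (In other words, $F(x,v)=\exp_x(-2f(|v|)\,jv)$ for the exponential map of $g$, since the geodesics of $g$ are the curves $t\mapsto[\cos(t/2)\,a+\sin(t/2)\,b]$ with $a,b\in\mathbb{C}^{n+1}$ unitarily orthonormal.) -/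

import Mathlib

open scoped Manifold ContDiff Topology LinearAlgebra.Projectivization

noncomputable section

/-! ### Exterior derivative on manifolds without boundary -/

section ExteriorDerivative

variable {E H M : Type*} [NormedAddCommGroup E] [NormedSpace ℝ E] [TopologicalSpace H]
  (I : ModelWithCorners ℝ E H) [TopologicalSpace M] [ChartedSpace H M] {k : ℕ}

/-- The expression of a differential `k`-form on `M` in the preferred chart at `p`, that is, its
pullback to the model vector space under the inverse of this chart. -/
def formInChart (α : ∀ q : M, TangentSpace I q [⋀^Fin k]→L[ℝ] ℝ) (p : M) :
    E → E [⋀^Fin k]→L[ℝ] ℝ := fun y =>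
  (α ((extChartAt I p).symm y)).compContinuousLinearMap
    (mfderiv 𝓘(ℝ, E) I (extChartAt I p).symm y)

/-- The exterior derivative of a differential `k`-form on a manifold without boundary, computed at
`p` in the preferred chart at `p`. -/
def manifoldExtDeriv (α : ∀ q : M, TangentSpace I q [⋀^Fin k]→L[ℝ] ℝ) (p : M) :
    TangentSpace I p [⋀^Fin (k + 1)]→L[ℝ] ℝ :=
  (extDeriv (formInChart I α p) (extChartAt I p p)).compContinuousLinearMap
    (mfderiv I 𝓘(ℝ, E) (extChartAt I p) p)

end ExteriorDerivative

/-! ### Real and complex projective space as smooth manifolds -/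

/-- The projective space of lines in `𝕜ⁿ⁺¹`. -/
abbrev ProjSpace (𝕜 : Type*) [Field 𝕜] (n : ℕ) : Type _ := ℙ 𝕜 (Fin (n + 1) → 𝕜)

namespace ProjSpace

section Topology

variable {𝕜 : Type*} [NormedField 𝕜] {n : ℕ}

/-- The quotient topology. -/
instance : TopologicalSpace (ProjSpace 𝕜 n) :=
  TopologicalSpace.coinduced (Projectivization.mk' 𝕜) inferInstance

theorem continuous_mk' :
    Continuous (Projectivization.mk' 𝕜 : {v : Fin (n + 1) → 𝕜 // v ≠ 0} → ProjSpace 𝕜 n) :=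
  continuous_coinduced_rng

theorem insertNth_one_ne_zero (i : Fin (n + 1)) (y : Fin n → 𝕜) :
    (i.insertNth (1 : 𝕜) y : Fin (n + 1) → 𝕜) ≠ 0 := fun h => by
  simpa using congrFun h i

/-- The `i`-th affine coordinates `[z] ↦ (z_j / z_i)_{j ≠ i}`. -/
def affineCoord (i : Fin (n + 1)) (p : ProjSpace 𝕜 n) : Fin n → 𝕜 :=
  fun j => p.rep (i.succAbove j) / p.rep i

theorem rep_mk (z : Fin (n + 1) → 𝕜) (hz : z ≠ 0) :
    ∃ a : 𝕜, a ≠ 0 ∧ (Projectivization.mk 𝕜 z hz).rep = a • z := by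
  obtain ⟨a, ha⟩ := Projectivization.exists_smul_eq_mk_rep 𝕜 z hz
  exact ⟨a, a.ne_zero, ha.symm⟩

theorem affineCoord_mk (i : Fin (n + 1)) (z : Fin (n + 1) → 𝕜) (hz : z ≠ 0) :
    affineCoord i (Projectivization.mk 𝕜 z hz) = fun j => z (i.succAbove j) / z i := by
  obtain ⟨a, ha, h⟩ := rep_mk z hz
  funext j
  simp only [affineCoord, h, Pi.smul_apply, smul_eq_mul]
  exact mul_div_mul_left _ _ ha

theorem mk_rep_apply_ne_zero (i : Fin (n + 1)) (z : Fin (n + 1) → 𝕜) (hz : z ≠ 0) :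
    (Projectivization.mk 𝕜 z hz).rep i ≠ 0 ↔ z i ≠ 0 := by
  obtain ⟨a, ha, h⟩ := rep_mk z hz
  simp [h, ha]

theorem mk_insertNth_affineCoord (i : Fin (n + 1)) (p : ProjSpace 𝕜 n) (hp : p.rep i ≠ 0) :
    Projectivization.mk 𝕜 (i.insertNth (1 : 𝕜) (affineCoord i p)) (insertNth_one_ne_zero i _)
      = p := by
  conv_rhs => rw [← p.mk_rep]
  rw [Projectivization.mk_eq_mk_iff']
  refine ⟨(p.rep i)⁻¹, ?_⟩
  funext j
  refine Fin.succAboveCases i ?_ (fun j => ?_) j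
  · simp [hp]
  · simp [affineCoord, div_eq_inv_mul]

theorem isOpen_affine (i : Fin (n + 1)) : IsOpen {p : ProjSpace 𝕜 n | p.rep i ≠ 0} := by
  rw [isOpen_coinduced]
  have : Projectivization.mk' 𝕜 ⁻¹' {p : ProjSpace 𝕜 n | p.rep i ≠ 0}
      = {v : {v : Fin (n + 1) → 𝕜 // v ≠ 0} | v.1 i ≠ 0} := by
    ext v
    exact mk_rep_apply_ne_zero i v.1 v.2
  rw [this]
  exact isOpen_ne_fun ((continuous_apply i).comp continuous_subtype_val) continuous_const

/-- The standard affine chart `[z] ↦ (z_j / z_i)_{j ≠ i}` on `{z_i ≠ 0}`, with inverse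
`y ↦ [y_0 : … : 1 : … : y_{n-1}]` (the entry `1` in position `i`). -/
def affineChart (i : Fin (n + 1)) : OpenPartialHomeomorph (ProjSpace 𝕜 n) (Fin n → 𝕜) where
  toFun := affineCoord i
  invFun y := Projectivization.mk 𝕜 (i.insertNth (1 : 𝕜) y) (insertNth_one_ne_zero i y)
  source := {p | p.rep i ≠ 0}
  target := Set.univ
  map_source' _ _ := Set.mem_univ _
  map_target' y _ := by
    simp only [Set.mem_ofPred_eq, mk_rep_apply_ne_zero]
    simp
  left_inv' p hp := mk_insertNth_affineCoord i p hp
  right_inv' y _ := by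
    rw [affineCoord_mk]
    simp
  open_source := isOpen_affine i
  open_target := isOpen_univ
  continuousOn_toFun := by
    rw [continuousOn_open_iff (isOpen_affine i)]
    intro t ht
    rw [isOpen_coinduced]
    have : Projectivization.mk' 𝕜 ⁻¹'
          ({p : ProjSpace 𝕜 n | p.rep i ≠ 0} ∩ affineCoord i ⁻¹' t)
        = {v : {v : Fin (n + 1) → 𝕜 // v ≠ 0} | v.1 i ≠ 0} ∩
          (fun v => fun j => v.1 (i.succAbove j) / v.1 i) ⁻¹' t := by
      ext v
      simp only [Set.mem_preimage, Set.mem_inter_iff, Set.mem_ofPred_eq, Projectivization.mk'_eq_mk,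
        mk_rep_apply_ne_zero, affineCoord_mk]
    rw [this]
    refine ContinuousOn.isOpen_inter_preimage ?_
      (isOpen_ne_fun ((continuous_apply i).comp continuous_subtype_val) continuous_const) ht
    refine continuousOn_pi.2 fun j => ContinuousOn.div ?_ ?_ fun v hv => hv
    · exact ((continuous_apply _).comp continuous_subtype_val).continuousOn
    · exact ((continuous_apply _).comp continuous_subtype_val).continuousOn
  continuousOn_invFun := by
    have h : Continuous fun y : Fin n → 𝕜 => (i.insertNth (1 : 𝕜) y : Fin (n + 1) → 𝕜) :=
      Continuous.finInsertNth i continuous_const continuous_id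
    exact (continuous_mk'.comp (h.subtype_mk (insertNth_one_ne_zero i))).continuousOn

theorem exists_rep_apply_ne_zero (p : ProjSpace 𝕜 n) : ∃ i, p.rep i ≠ 0 :=
  Function.ne_iff.1 p.rep_nonzero

/-- The index of the preferred affine chart at `p`: some `i` with `p_i ≠ 0`. -/
def chartIdx (p : ProjSpace 𝕜 n) : Fin (n + 1) := p.exists_rep_apply_ne_zero.choose

theorem rep_chartIdx_ne_zero (p : ProjSpace 𝕜 n) : p.rep p.chartIdx ≠ 0 :=
  p.exists_rep_apply_ne_zero.choose_spec

/-- Projective space with its `n + 1` standard affine charts. -/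
instance : ChartedSpace (Fin n → 𝕜) (ProjSpace 𝕜 n) where
  atlas := Set.range affineChart
  chartAt p := affineChart p.chartIdx
  mem_chart_source := rep_chartIdx_ne_zero
  chart_mem_atlas _ := Set.mem_range_self _

end Topology

section Smooth

variable {𝕜 : Type*} [RCLike 𝕜] {n : ℕ}

theorem contDiffOn_transition (i j : Fin (n + 1)) (k : WithTop ℕ∞) :
    ContDiffOn ℝ k ((affineChart i).symm.trans (affineChart j) : (Fin n → 𝕜) → (Fin n → 𝕜))
      ((affineChart i).symm.trans (affineChart j)).source := by
  have key : ∀ l : Fin (n + 1), ContDiff ℝ k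
      (fun y : Fin n → 𝕜 => (i.insertNth (1 : 𝕜) y : Fin (n + 1) → 𝕜) l) := by
    intro l
    refine Fin.succAboveCases i ?_ (fun l => ?_) l
    · simpa using (contDiff_const : ContDiff ℝ k fun _ : Fin n → 𝕜 => (1 : 𝕜))
    · simpa using (contDiff_apply ℝ 𝕜 l : ContDiff ℝ k fun y : Fin n → 𝕜 => y l)
  have hsrc : ∀ y ∈ ((affineChart i).symm.trans (affineChart j) :
      OpenPartialHomeomorph (Fin n → 𝕜) (Fin n → 𝕜)).source,
      (i.insertNth (1 : 𝕜) y : Fin (n + 1) → 𝕜) j ≠ 0 := by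
    intro y hy
    have := ((OpenPartialHomeomorph.trans_source (affineChart i).symm (affineChart j)).subset hy).2
    exact (mk_rep_apply_ne_zero j _ (insertNth_one_ne_zero i y)).1 this
  have : ∀ y, ((affineChart i).symm.trans (affineChart j) : (Fin n → 𝕜) → (Fin n → 𝕜)) y
      = fun l => (i.insertNth (1 : 𝕜) y : Fin (n + 1) → 𝕜) (j.succAbove l) /
        (i.insertNth (1 : 𝕜) y : Fin (n + 1) → 𝕜) j := fun y =>
    affineCoord_mk j _ (insertNth_one_ne_zero i y)
  refine ContDiffOn.congr ?_ fun y _ => this y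
  refine contDiffOn_pi.2 fun l => ?_
  simp only [div_eq_mul_inv]
  exact (key _).contDiffOn.mul ((key j).contDiffOn.inv hsrc)

/-- Real and complex projective space are (real) smooth, indeed analytic, manifolds. -/
instance (k : WithTop ℕ∞) : IsManifold 𝓘(ℝ, Fin n → 𝕜) k (ProjSpace 𝕜 n) := by
  refine isManifold_of_contDiffOn _ _ _ ?_
  rintro _ _ ⟨i, rfl⟩ ⟨j, rfl⟩
  simpa using contDiffOn_transition i j k

end Smooth

/-! ### The Fubini-Study metric, the round metric, and the Fubini-Study form -/

section Metric

variable {𝕜 : Type*} [RCLike 𝕜] {n : ℕ}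

/-- The form `4 Re (⟨ξ, η⟩ / |z|² - ⟨ξ, z⟩ ⟨z, η⟩ / |z|⁴)` on vectors `ξ`, `η` at `z ≠ 0` in `𝕜ⁿ⁺¹`:
the pullback of the metric on projective space under `z ↦ [z]`. -/
def liftedMetric (z ξ η : Fin (n + 1) → 𝕜) : ℝ :=
  4 * RCLike.re ((star ξ ⬝ᵥ η) / (star z ⬝ᵥ z)
    - (star ξ ⬝ᵥ z) * (star z ⬝ᵥ η) / (star z ⬝ᵥ z) ^ 2)

/-- The representative `z` of `p` with `z_i = 1`, for the index `i` of the preferred chart. -/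
def affineRep (p : ProjSpace 𝕜 n) : Fin (n + 1) → 𝕜 :=
  p.chartIdx.insertNth (1 : 𝕜) (affineCoord p.chartIdx p)

/-- The lift of a tangent vector at `p`, given in the preferred affine chart (with index `i`), to a
vector at `affineRep p`, by the section `y ↦ (y_0, …, 1, …, y_{n-1})` of this chart: a zero is
inserted in position `i`. -/
def tangentLift (p : ProjSpace 𝕜 n) : TangentSpace 𝓘(ℝ, Fin n → 𝕜) p →ₗ[ℝ] (Fin (n + 1) → 𝕜) :=
  show (Fin n → 𝕜) →ₗ[ℝ] (Fin (n + 1) → 𝕜) from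
  { toFun := fun X => p.chartIdx.insertNth (0 : 𝕜) X
    map_add' := fun x y => by
      funext l
      refine Fin.succAboveCases p.chartIdx ?_ (fun l => ?_) l <;> simp
    map_smul' := fun c y => by
      funext l
      refine Fin.succAboveCases p.chartIdx ?_ (fun l => ?_) l <;> simp }

/-- For `𝕜 = ℂ` this is the Fubini-Study metric, scaled so that complex projective lines are round
spheres of radius one. For `𝕜 = ℝ` it is the metric induced on `ℝPⁿ ⊆ ℂPⁿ`: the round metric for
which the double cover `Sⁿ → ℝPⁿ` is a local isometry on the sphere of radius two, so that the
prime geodesics have length `2π`. -/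
def metric (p : ProjSpace 𝕜 n) (X Y : TangentSpace 𝓘(ℝ, Fin n → 𝕜) p) : ℝ :=
  liftedMetric p.affineRep (p.tangentLift X) (p.tangentLift Y)

theorem liftedMetric_add_right (z ξ η ζ : Fin (n + 1) → 𝕜) :
    liftedMetric z ξ (η + ζ) = liftedMetric z ξ η + liftedMetric z ξ ζ := by
  simp only [liftedMetric, dotProduct_add]
  rw [← mul_add, ← map_add]
  congr 2
  ring

theorem liftedMetric_smul_right (z ξ η : Fin (n + 1) → 𝕜) (c : ℝ) :
    liftedMetric z ξ (c • η) = c * liftedMetric z ξ η := by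
  simp only [liftedMetric, dotProduct_smul, RCLike.real_smul_eq_coe_mul]
  rw [mul_left_comm c 4, ← RCLike.re_ofReal_mul c]
  congr 2
  ring

/-- The linear form `g_p(X, ·)` on the tangent space at `p`. -/
def metricForm (p : ProjSpace 𝕜 n) (X : TangentSpace 𝓘(ℝ, Fin n → 𝕜) p) :
    TangentSpace 𝓘(ℝ, Fin n → 𝕜) p →L[ℝ] ℝ where
  toFun := metric p X
  map_add' Y Z := by simp only [metric, map_add, liftedMetric_add_right]
  map_smul' c Y := by
    simp only [metric, map_smul, liftedMetric_smul_right, RingHom.id_apply, smul_eq_mul]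
  cont := by
    have h : Continuous fun Y : Fin n → 𝕜 =>
        liftedMetric p.affineRep (p.tangentLift X) (p.chartIdx.insertNth (0 : 𝕜) Y) := by
      have h' : Continuous fun Y : Fin n → 𝕜 =>
          (p.chartIdx.insertNth (0 : 𝕜) Y : Fin (n + 1) → 𝕜) :=
        Continuous.finInsertNth p.chartIdx continuous_const continuous_id
      have h1 : Continuous fun η : Fin (n + 1) → 𝕜 =>
          liftedMetric p.affineRep (p.tangentLift X) η := by
        unfold liftedMetric dotProduct
        fun_prop
      exact h1.comp h'
    exact h

/-- The complex structure of `ℂPⁿ`: multiplication by `i` in the (holomorphic) affine charts. -/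
def complexStructure (p : ProjSpace ℂ n) (X : TangentSpace 𝓘(ℝ, Fin n → ℂ) p) :
    TangentSpace 𝓘(ℝ, Fin n → ℂ) p :=
  (fun l => Complex.I * X l : Fin n → ℂ)

/-- The Fubini-Study form `ω(X, Y) = g(jX, Y)` on `ℂPⁿ`. On `ℂP¹` it is `4 dx ∧ dy / (1 + x² + y²)²` in the affine coordinate
`x + iy`, so that complex projective lines have area `4π`. -/
def fubiniStudyForm (p : ProjSpace ℂ n) (X Y : TangentSpace 𝓘(ℝ, Fin n → ℂ) p) : ℝ :=
  metric p (complexStructure p X) Y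

end Metric

/-! ### The disc tangent bundle of `ℝPⁿ` and its symplectic form -/

section TangentBundle

variable {n : ℕ}

/-- The tangent bundle of `ℝPⁿ`. -/
abbrev TRP (n : ℕ) : Type := TangentBundle 𝓘(ℝ, Fin n → ℝ) (ProjSpace ℝ n)

/-- The open unit disc tangent bundle of `ℝPⁿ`. -/
def unitDiscBundle (n : ℕ) : Set (TRP n) := {q | metric q.proj q.snd q.snd < 1}

/-- The pullback to the tangent bundle, under the metric, of the canonical one-form:
`λ_{(x,v)}(ξ) = g_x(v, dπ ξ)`. -/
def canonicalForm (q : TRP n) : TangentSpace 𝓘(ℝ, Fin n → ℝ).tangent q →L[ℝ] ℝ :=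
  (metricForm q.proj q.snd).comp
    (mfderiv 𝓘(ℝ, Fin n → ℝ).tangent 𝓘(ℝ, Fin n → ℝ) (fun q : TRP n => q.proj) q)

/-- The symplectic form `dλ` on the tangent bundle of `ℝPⁿ`. -/
def dCanonicalForm (q : TRP n) : TangentSpace 𝓘(ℝ, Fin n → ℝ).tangent q [⋀^Fin 2]→L[ℝ] ℝ :=
  manifoldExtDeriv 𝓘(ℝ, Fin n → ℝ).tangent
    (fun q : TRP n => ContinuousAlternatingMap.ofSubsingleton ℝ _ ℝ (0 : Fin 1) (canonicalForm q)) q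

end TangentBundle

/-! ### The quadric and the action of the special orthogonal group -/

/-- The quadric `z_0² + … + z_n² = 0`. -/
def quadric (n : ℕ) : Set (ProjSpace ℂ n) :=
  {p | ∃ (z : Fin (n + 1) → ℂ) (hz : z ≠ 0), p = Projectivization.mk ℂ z hz ∧ ∑ i, z i ^ 2 = 0}

section Action

variable (𝕜 : Type*) [RCLike 𝕜] {n : ℕ}

theorem mulVecLin_injective (A : Matrix.specialOrthogonalGroup (Fin (n + 1)) ℝ) :
    Function.Injective ((A.1.map (algebraMap ℝ 𝕜)).mulVecLin) := by
  have h : A.1.det = 1 := (Matrix.mem_specialOrthogonalGroup_iff.1 A.2).2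
  apply Matrix.mulVec_injective_of_isUnit
  rw [Matrix.isUnit_iff_isUnit_det, ← RingHom.mapMatrix_apply, ← RingHom.map_det, h, map_one]
  exact isUnit_one

/-- The action `A · [z] = [A z]` of `SO(n + 1)` on real and complex projective space. -/
def rotate (A : Matrix.specialOrthogonalGroup (Fin (n + 1)) ℝ) (p : ProjSpace 𝕜 n) :
    ProjSpace 𝕜 n :=
  p.map (A.1.map (algebraMap ℝ 𝕜)).mulVecLin (mulVecLin_injective 𝕜 A)

/-- The action of `SO(n + 1)` on the tangent bundle of `ℝPⁿ`, by differentials of its action on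
`ℝPⁿ`. -/
def rotateTangent (A : Matrix.specialOrthogonalGroup (Fin (n + 1)) ℝ) : TRP n → TRP n :=
  tangentMap 𝓘(ℝ, Fin n → ℝ) 𝓘(ℝ, Fin n → ℝ) (rotate ℝ A)

/-- The class `[z]` of a vector `z ≠ 0` (with an irrelevant value at `z = 0`). -/
def ofVec (z : Fin (n + 1) → 𝕜) : ProjSpace 𝕜 n :=
  open Classical in
  if hz : z = 0 then Projectivization.mk 𝕜 (Pi.single 0 1) (by simp)
  else Projectivization.mk 𝕜 z hz

end Action

end ProjSpace

/-- A diffeomorphism from the open subset `U` of `M` onto the open subset `V` of `N`. -/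
structure IsDiffeoOnto {E H M E' H' N : Type*}
    [NormedAddCommGroup E] [NormedSpace ℝ E] [TopologicalSpace H] (I : ModelWithCorners ℝ E H)
    [TopologicalSpace M] [ChartedSpace H M]
    [NormedAddCommGroup E'] [NormedSpace ℝ E'] [TopologicalSpace H'] (J : ModelWithCorners ℝ E' H')
    [TopologicalSpace N] [ChartedSpace H' N]
    (F : M → N) (U : Set M) (V : Set N) : Prop where
  isOpen_source : IsOpen U
  isOpen_target : IsOpen V
  bijOn : Set.BijOn F U V
  contMDiffOn : ContMDiffOn I J ∞ F U
  exists_inverse : ∃ G : N → M, ContMDiffOn J I ∞ G V ∧ Set.LeftInvOn G F U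

end

noncomputable section

namespace ProjSpace

/-! ### Homogeneous vectors as coordinates on projective space -/

section OfVec

variable {𝕜 : Type*} [RCLike 𝕜] {n : ℕ}

/-! Everything is lifted to homogeneous vectors. A tangent vector of `ℝPⁿ` is a class of pairs `(a,
b)` with `a ≠ 0`, where `(t a, t b + k a)` represents the same vector for `t ≠ 0`. Let `s` be the
part of `b` orthogonal to `a`, so that `ρ = |v|² = 4|s|²/|a|²`. The map is induced by `Φ(a, b) = c a
- i s`, where `c = (1 + √(1 - ρ))/2` is the larger root of `c² - c + ρ/4 = 0`. Equivalently, `|Φ|² =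
c²|a|² + |s|² = c|a|²`. For `a = u`, `b = (r/2) w` and `r = sin 2θ` this gives `c = cos² θ`, and `Φ`
is `cos θ` times `cos θ u - i sin θ w`.

Symplectic: `α = 2 Im⟨z, dz⟩/|z|²` is a primitive of the lifted Fubini-Study form
(`extDeriv_potentialForm`). In `Φ*α` the term with `dc` vanishes because `a ⊥ s`, and
differentiating `a · s = 0` gives `a · ds = -s · da`. What remains is `4c s·da/(c|a|²) = 4
s·da/|a|²`, which is the canonical one-form (`potential_fderiv_liftedMap`). Since `d` commutes with
pullbacks, this identity in a chart of the tangent bundle proves the claim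
(`formInChart_canonicalForm`, `fubiniStudyForm_mfderiv_discMap`).

Bijective: `∑ z_k²` is real and positive on the image of `Φ` when `ρ < 1`. Conversely, a point off
the quadric has a representative `x + iy` with this property, unique up to a nonzero real factor
(`exists_smul_sumSqPos`, `discMapInv_ofVec`). It means that `x ⊥ y` and `|y| < |x|`, and `(a, b)` is
recovered from `x` and `y` by a rational formula. Smoothness of the inverse requires a smooth local
choice of the phase (`phaseCorrection`). Equivariance holds because `Φ` is built from dot products
and real linear combinations. -/

theorem star_dotProduct_self_ne_zero {z : Fin (n + 1) → 𝕜} (hz : z ≠ 0) : star z ⬝ᵥ z ≠ 0 := by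
  open ComplexOrder in
  exact fun h => hz (dotProduct_star_self_eq_zero.1 h)

/-- The lifted metric at `z` only depends on the tangent vectors of projective space at `[z]` which
are represented by its arguments. -/
theorem liftedMetric_smul_add {z : Fin (n + 1) → 𝕜} (hz : z ≠ 0) (ξ η : Fin (n + 1) → 𝕜)
    {t : 𝕜} (ht : t ≠ 0) (k l : 𝕜) :
    liftedMetric (t • z) (t • ξ + k • z) (t • η + l • z) = liftedMetric z ξ η := by
  have hN := star_dotProduct_self_ne_zero hz
  have ht' : star t ≠ 0 := star_ne_zero.2 ht
  simp only [liftedMetric, star_add, star_smul, dotProduct_add, add_dotProduct, dotProduct_smul,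
    smul_dotProduct, smul_eq_mul]
  congr 2
  field_simp
  ring

theorem ofVec_of_ne_zero {z : Fin (n + 1) → 𝕜} (hz : z ≠ 0) :
    ofVec 𝕜 z = Projectivization.mk 𝕜 z hz := dif_neg hz

theorem ofVec_smul {c : 𝕜} (hc : c ≠ 0) (z : Fin (n + 1) → 𝕜) : ofVec 𝕜 (c • z) = ofVec 𝕜 z := by
  by_cases hz : z = 0
  · simp [hz]
  · rw [ofVec_of_ne_zero hz, ofVec_of_ne_zero (smul_ne_zero hc hz), Projectivization.mk_eq_mk_iff']
    exact ⟨c, rfl⟩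

theorem ofVec_eq_iff {z w : Fin (n + 1) → 𝕜} (hz : z ≠ 0) (hw : w ≠ 0) :
    ofVec 𝕜 z = ofVec 𝕜 w ↔ ∃ c : 𝕜, c ≠ 0 ∧ z = c • w := by
  constructor
  · intro h
    rw [ofVec_of_ne_zero hz, ofVec_of_ne_zero hw, Projectivization.mk_eq_mk_iff'] at h
    obtain ⟨c, rfl⟩ := h
    exact ⟨c, fun h => hz (by simp [h]), rfl⟩
  · rintro ⟨c, hc, rfl⟩
    exact ofVec_smul hc w

theorem ofVec_rep (p : ProjSpace 𝕜 n) : ofVec 𝕜 p.rep = p := by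
  rw [ofVec_of_ne_zero p.rep_nonzero, p.mk_rep]

theorem ofVec_rep_apply_ne_zero {z : Fin (n + 1) → 𝕜} (hz : z ≠ 0) (i : Fin (n + 1)) :
    (ofVec 𝕜 z).rep i ≠ 0 ↔ z i ≠ 0 := by
  rw [ofVec_of_ne_zero hz, mk_rep_apply_ne_zero]

theorem apply_chartIdx_ne_zero {z : Fin (n + 1) → 𝕜} (hz : z ≠ 0) :
    z (ofVec 𝕜 z).chartIdx ≠ 0 :=
  (ofVec_rep_apply_ne_zero hz _).1 (rep_chartIdx_ne_zero _)

theorem affineCoord_ofVec (i : Fin (n + 1)) {z : Fin (n + 1) → 𝕜} (hz : z ≠ 0) :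
    affineCoord i (ofVec 𝕜 z) = fun j => z (i.succAbove j) / z i := by
  rw [ofVec_of_ne_zero hz, affineCoord_mk]

theorem affineChart_symm_apply (i : Fin (n + 1)) (y : Fin n → 𝕜) :
    (affineChart i).symm y = ofVec 𝕜 (i.insertNth (1 : 𝕜) y : Fin (n + 1) → 𝕜) :=
  (ofVec_of_ne_zero (insertNth_one_ne_zero i y)).symm

theorem affineChart_symm_affineCoord_ofVec {i : Fin (n + 1)} {z : Fin (n + 1) → 𝕜}
    (hz : z i ≠ 0) :
    (affineChart i).symm (fun j => z (i.succAbove j) / z i) = ofVec 𝕜 z := by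
  have hz0 : z ≠ 0 := fun h => hz (by simp [h])
  rw [← affineCoord_ofVec i hz0]
  exact (affineChart i).left_inv ((ofVec_rep_apply_ne_zero hz0 i).2 hz)

theorem contDiff_insertNth (i : Fin (n + 1)) (c : 𝕜) {k : WithTop ℕ∞} :
    ContDiff ℝ k (fun y : Fin n → 𝕜 => (i.insertNth c y : Fin (n + 1) → 𝕜)) := by
  refine contDiff_pi.2 fun l => ?_
  refine Fin.succAboveCases i ?_ (fun l => ?_) l
  · simpa using contDiff_const
  · simpa using (contDiff_apply ℝ 𝕜 l : ContDiff ℝ k fun y : Fin n → 𝕜 => y l)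

theorem contDiffAt_affineQuotient {i : Fin (n + 1)} {z : Fin (n + 1) → 𝕜} (hz : z i ≠ 0)
    {k : WithTop ℕ∞} :
    ContDiffAt ℝ k (fun (z : Fin (n + 1) → 𝕜) (j : Fin n) => z (i.succAbove j) / z i) z := by
  refine contDiffAt_pi.2 fun j => ?_
  simp only [div_eq_mul_inv]
  exact (contDiff_apply ℝ 𝕜 _).contDiffAt.mul ((contDiff_apply ℝ 𝕜 i).contDiffAt.inv hz)

theorem contMDiff_affineChart_symm (i : Fin (n + 1)) {k : WithTop ℕ∞} :
    ContMDiff 𝓘(ℝ, Fin n → 𝕜) 𝓘(ℝ, Fin n → 𝕜) k (affineChart (𝕜 := 𝕜) i).symm := by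
  have := contMDiffOn_symm_of_mem_maximalAtlas (I := 𝓘(ℝ, Fin n → 𝕜)) (n := k)
    (IsManifold.subset_maximalAtlas (I := 𝓘(ℝ, Fin n → 𝕜)) (Set.mem_range_self i :
      affineChart (𝕜 := 𝕜) i ∈ atlas (Fin n → 𝕜) (ProjSpace 𝕜 n)))
  exact contMDiffOn_univ.1 this

theorem contMDiffAt_affineChart {i : Fin (n + 1)} {p : ProjSpace 𝕜 n} (hp : p.rep i ≠ 0)
    {k : WithTop ℕ∞} :
    ContMDiffAt 𝓘(ℝ, Fin n → 𝕜) 𝓘(ℝ, Fin n → 𝕜) k (affineCoord (𝕜 := 𝕜) i) p := by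
  have := contMDiffOn_of_mem_maximalAtlas (I := 𝓘(ℝ, Fin n → 𝕜)) (n := k)
    (IsManifold.subset_maximalAtlas (I := 𝓘(ℝ, Fin n → 𝕜)) (Set.mem_range_self i :
      affineChart (𝕜 := 𝕜) i ∈ atlas (Fin n → 𝕜) (ProjSpace 𝕜 n)))
  exact this.contMDiffAt ((isOpen_affine i).mem_nhds hp)

theorem contMDiffAt_ofVec {z : Fin (n + 1) → 𝕜} (hz : z ≠ 0) {k : WithTop ℕ∞} :
    ContMDiffAt 𝓘(ℝ, Fin (n + 1) → 𝕜) 𝓘(ℝ, Fin n → 𝕜) k (ofVec 𝕜) z := by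
  obtain ⟨i, hi⟩ := Function.ne_iff.1 hz
  have h := (contMDiff_affineChart_symm (𝕜 := 𝕜) i (k := k)).contMDiffAt.comp z
    (contDiffAt_affineQuotient hi (k := k)).contMDiffAt
  refine h.congr_of_eventuallyEq ?_
  filter_upwards [(isOpen_ne_fun (continuous_apply i) continuous_const).mem_nhds hi] with w hw
  exact (affineChart_symm_affineCoord_ofVec hw).symm

theorem mdifferentiableAt_ofVec {z : Fin (n + 1) → 𝕜} (hz : z ≠ 0) :
    MDifferentiableAt 𝓘(ℝ, Fin (n + 1) → 𝕜) 𝓘(ℝ, Fin n → 𝕜) (ofVec 𝕜) z :=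
  (contMDiffAt_ofVec hz (k := 1)).mdifferentiableAt one_ne_zero

/-- The derivative at `z` of `z ↦ (z_j / z_i)_{j ≠ i}`. -/
def affineQuotientDeriv (i : Fin (n + 1)) (z : Fin (n + 1) → 𝕜) :
    (Fin (n + 1) → 𝕜) →L[ℝ] (Fin n → 𝕜) :=
  ContinuousLinearMap.pi fun j : Fin n =>
    z (i.succAbove j) • (-((z i) ^ 2)⁻¹ • ContinuousLinearMap.proj (R := ℝ) i)
      + (z i)⁻¹ • ContinuousLinearMap.proj (R := ℝ) (φ := fun _ : Fin (n + 1) => 𝕜) (i.succAbove j)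

theorem affineQuotientDeriv_apply (i : Fin (n + 1)) (z ξ : Fin (n + 1) → 𝕜) (j : Fin n) :
    affineQuotientDeriv i z ξ j
      = (z i)⁻¹ * ξ (i.succAbove j) - ξ i / z i ^ 2 * z (i.succAbove j) := by
  simp [affineQuotientDeriv, div_eq_mul_inv]
  ring

theorem hasFDerivAt_affineQuotient {i : Fin (n + 1)} {z : Fin (n + 1) → 𝕜} (hi : z i ≠ 0) :
    HasFDerivAt (fun (z : Fin (n + 1) → 𝕜) (j : Fin n) => z (i.succAbove j) / z i)
      (affineQuotientDeriv i z) z := by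
  refine hasFDerivAt_pi.2 fun j => ?_
  simp only [div_eq_mul_inv]
  have h1 := (ContinuousLinearMap.proj (R := ℝ) (φ := fun _ : Fin (n + 1) => 𝕜)
    (i.succAbove j)).hasFDerivAt (x := z)
  have h2 := (ContinuousLinearMap.proj (R := ℝ) (φ := fun _ : Fin (n + 1) => 𝕜)
    i).hasFDerivAt (x := z)
  have h3 := ((hasDerivAt_inv hi).hasFDerivAt.restrictScalars ℝ).comp z h2
  convert! h1.mul h3 using 1
  ext w
  simp [mul_comm]

/-- The derivative is read in the preferred chart at `[z]`, where the projection is the quotient map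
`z ↦ (z_j / z_i)`; hence the index `(ofVec 𝕜 z).chartIdx`. -/
theorem mfderiv_ofVec {z : Fin (n + 1) → 𝕜} (hz : z ≠ 0) :
    mfderiv 𝓘(ℝ, Fin (n + 1) → 𝕜) 𝓘(ℝ, Fin n → 𝕜) (ofVec 𝕜) z
      = affineQuotientDeriv (ofVec 𝕜 z).chartIdx z := by
  rw [(mdifferentiableAt_ofVec hz).mfderiv]
  have hev : writtenInExtChartAt 𝓘(ℝ, Fin (n + 1) → 𝕜) 𝓘(ℝ, Fin n → 𝕜) z (ofVec 𝕜)
      =ᶠ[𝓝 z] fun (z' : Fin (n + 1) → 𝕜) (j : Fin n) =>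
        z' ((ofVec 𝕜 z).chartIdx.succAbove j) / z' (ofVec 𝕜 z).chartIdx := by
    filter_upwards [isOpen_ne.mem_nhds hz] with w hw
    exact affineCoord_ofVec _ hw
  simp only [modelWithCornersSelf_coe, Set.range_id, fderivWithin_univ]
  exact ((hasFDerivAt_affineQuotient (apply_chartIdx_ne_zero hz)).congr_of_eventuallyEq hev).fderiv

theorem affineRep_ofVec {z : Fin (n + 1) → 𝕜} (hz : z ≠ 0) :
    (ofVec 𝕜 z).affineRep = (z (ofVec 𝕜 z).chartIdx)⁻¹ • z := by
  have hi := apply_chartIdx_ne_zero hz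
  unfold affineRep
  rw [affineCoord_ofVec _ hz]
  funext l
  refine Fin.succAboveCases (ofVec 𝕜 z).chartIdx ?_ (fun l => ?_) l
  · simp [hi]
  · simp [div_eq_inv_mul]

/-- Projection followed by the affine section is `z ↦ z / z_i`, and this is its derivative. The
shape `t • ξ + k • z` is what `liftedMetric_smul_add` absorbs. -/
theorem tangentLift_mfderiv_ofVec {z : Fin (n + 1) → 𝕜} (hz : z ≠ 0) (ξ : Fin (n + 1) → 𝕜) :
    (ofVec 𝕜 z).tangentLift (mfderiv 𝓘(ℝ, Fin (n + 1) → 𝕜) 𝓘(ℝ, Fin n → 𝕜) (ofVec 𝕜) z ξ)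
      = (z (ofVec 𝕜 z).chartIdx)⁻¹ • ξ
        + (-(ξ (ofVec 𝕜 z).chartIdx / z (ofVec 𝕜 z).chartIdx ^ 2)) • z := by
  have hi := apply_chartIdx_ne_zero hz
  rw [mfderiv_ofVec hz]
  change ((ofVec 𝕜 z).chartIdx.insertNth (0 : 𝕜)
    (affineQuotientDeriv (ofVec 𝕜 z).chartIdx z ξ) : Fin (n + 1) → 𝕜) = _
  funext l
  refine Fin.succAboveCases (ofVec 𝕜 z).chartIdx ?_ (fun l => ?_) l
  · simp only [Fin.insertNth_apply_same, Pi.add_apply, Pi.smul_apply, smul_eq_mul]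
    field_simp
    ring
  · simp only [Fin.insertNth_apply_succAbove, Pi.add_apply, Pi.smul_apply, smul_eq_mul,
      affineQuotientDeriv_apply]
    ring

/-- The pullback of the metric under `z ↦ [z]` is the lifted metric. -/
theorem metric_mfderiv_ofVec {z : Fin (n + 1) → 𝕜} (hz : z ≠ 0) (ξ η : Fin (n + 1) → 𝕜) :
    metric (ofVec 𝕜 z) (mfderiv 𝓘(ℝ, Fin (n + 1) → 𝕜) 𝓘(ℝ, Fin n → 𝕜) (ofVec 𝕜) z ξ)
      (mfderiv 𝓘(ℝ, Fin (n + 1) → 𝕜) 𝓘(ℝ, Fin n → 𝕜) (ofVec 𝕜) z η) = liftedMetric z ξ η := by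
  unfold metric
  rw [affineRep_ofVec hz, tangentLift_mfderiv_ofVec hz, tangentLift_mfderiv_ofVec hz,
    liftedMetric_smul_add hz _ _ (inv_ne_zero (apply_chartIdx_ne_zero hz))]

theorem affineRep_ne_zero (p : ProjSpace 𝕜 n) : p.affineRep ≠ 0 := insertNth_one_ne_zero _ _

theorem ofVec_affineRep (p : ProjSpace 𝕜 n) : ofVec 𝕜 p.affineRep = p := by
  rw [ofVec_of_ne_zero p.affineRep_ne_zero]
  exact mk_insertNth_affineCoord _ _ p.rep_chartIdx_ne_zero

/-- A map on projective space is smooth where its composition with `z ↦ [z]` is. -/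
theorem contMDiffAt_of_comp_ofVec {E' H' N : Type*} [NormedAddCommGroup E'] [NormedSpace ℝ E']
    [TopologicalSpace H'] {J : ModelWithCorners ℝ E' H'} [TopologicalSpace N] [ChartedSpace H' N]
    {f : ProjSpace 𝕜 n → N} {p : ProjSpace 𝕜 n} {k : WithTop ℕ∞}
    (h : ContMDiffAt 𝓘(ℝ, Fin (n + 1) → 𝕜) J k (f ∘ ofVec 𝕜) p.affineRep) :
    ContMDiffAt 𝓘(ℝ, Fin n → 𝕜) J k f p := by
  have hs : ContMDiffAt 𝓘(ℝ, Fin n → 𝕜) 𝓘(ℝ, Fin (n + 1) → 𝕜) k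
      (fun p' : ProjSpace 𝕜 n =>
        (p.chartIdx.insertNth (1 : 𝕜) (affineCoord p.chartIdx p') : Fin (n + 1) → 𝕜)) p :=
    (contDiff_insertNth p.chartIdx (1 : 𝕜)).contMDiff.contMDiffAt.comp p
      (contMDiffAt_affineChart p.rep_chartIdx_ne_zero)
  refine (ContMDiffAt.comp p (f := fun p' : ProjSpace 𝕜 n =>
    (p.chartIdx.insertNth (1 : 𝕜) (affineCoord p.chartIdx p') : Fin (n + 1) → 𝕜))
    h hs).congr_of_eventuallyEq ?_
  filter_upwards [(isOpen_affine p.chartIdx).mem_nhds p.rep_chartIdx_ne_zero] with p' hp'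
  have : ofVec 𝕜 (p.chartIdx.insertNth (1 : 𝕜) (affineCoord p.chartIdx p') : Fin (n + 1) → 𝕜)
      = p' := by
    rw [ofVec_of_ne_zero (insertNth_one_ne_zero _ _)]
    exact mk_insertNth_affineCoord _ _ hp'
  simp only [Function.comp_apply, this]

end OfVec

/-- The projection is holomorphic in affine charts, so its derivative is complex linear. -/
theorem complexStructure_mfderiv_ofVec {n : ℕ} {z : Fin (n + 1) → ℂ} (hz : z ≠ 0)
    (ξ : Fin (n + 1) → ℂ) :
    complexStructure (ofVec ℂ z)
        (mfderiv 𝓘(ℝ, Fin (n + 1) → ℂ) 𝓘(ℝ, Fin n → ℂ) (ofVec ℂ) z ξ)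
      = mfderiv 𝓘(ℝ, Fin (n + 1) → ℂ) 𝓘(ℝ, Fin n → ℂ) (ofVec ℂ) z (Complex.I • ξ) := by
  rw [mfderiv_ofVec hz]
  refine funext fun j => ?_
  change Complex.I * affineQuotientDeriv (ofVec ℂ z).chartIdx z ξ j
    = affineQuotientDeriv (ofVec ℂ z).chartIdx z (Complex.I • ξ) j
  simp only [affineQuotientDeriv_apply, Pi.smul_apply, smul_eq_mul]
  ring

/-- The pullback of the Fubini-Study form under `z ↦ [z]`. -/
theorem fubiniStudyForm_mfderiv_ofVec {n : ℕ} {z : Fin (n + 1) → ℂ} (hz : z ≠ 0)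
    (ξ η : Fin (n + 1) → ℂ) :
    fubiniStudyForm (ofVec ℂ z) (mfderiv 𝓘(ℝ, Fin (n + 1) → ℂ) 𝓘(ℝ, Fin n → ℂ) (ofVec ℂ) z ξ)
      (mfderiv 𝓘(ℝ, Fin (n + 1) → ℂ) 𝓘(ℝ, Fin n → ℂ) (ofVec ℂ) z η)
      = liftedMetric z (Complex.I • ξ) η := by
  unfold fubiniStudyForm
  rw [complexStructure_mfderiv_ofVec hz, metric_mfderiv_ofVec hz]

/-! ### Tangent vectors of `ℝPⁿ` as classes of pairs of vectors -/

section TangentOfVec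

variable {n : ℕ}

/-- Insertion of a zero in position `i`. -/
def insertZero (i : Fin (n + 1)) : (Fin n → ℝ) →L[ℝ] (Fin (n + 1) → ℝ) :=
  LinearMap.toContinuousLinearMap
  { toFun := fun X => i.insertNth (0 : ℝ) X
    map_add' := fun x y => by
      funext l
      refine Fin.succAboveCases i ?_ (fun l => ?_) l <;> simp
    map_smul' := fun c y => by
      funext l
      refine Fin.succAboveCases i ?_ (fun l => ?_) l <;> simp }

theorem insertZero_apply (i : Fin (n + 1)) (y : Fin n → ℝ) :
    insertZero i y = (i.insertNth (0 : ℝ) y : Fin (n + 1) → ℝ) := rfl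

theorem insertNth_eq_insertZero_add (i : Fin (n + 1)) (c : ℝ) (y : Fin n → ℝ) :
    (i.insertNth c y : Fin (n + 1) → ℝ) = insertZero i y + Pi.single i c := by
  funext l
  refine Fin.succAboveCases i ?_ (fun l => ?_) l <;> simp [insertZero_apply]

theorem hasFDerivAt_insertNth (i : Fin (n + 1)) (c : ℝ) (y : Fin n → ℝ) :
    HasFDerivAt (fun y : Fin n → ℝ => (i.insertNth c y : Fin (n + 1) → ℝ)) (insertZero i) y := by
  simp only [insertNth_eq_insertZero_add]
  exact (insertZero i).hasFDerivAt.add_const _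

/-- The tangent vector of `ℝPⁿ` at `[a]` represented by the vector `b` at `a`. -/
def tangentOfVec (a b : Fin (n + 1) → ℝ) : TRP n :=
  tangentMap 𝓘(ℝ, Fin (n + 1) → ℝ) 𝓘(ℝ, Fin n → ℝ) (ofVec ℝ) ⟨a, b⟩

/-- The tangent vector at `p` with components `x` in the preferred chart at `p`. -/
def tangentMk (p : ProjSpace ℝ n) (x : Fin n → ℝ) : TRP n := ⟨p, x⟩

theorem tangentOfVec_eq_tangentMk {a : Fin (n + 1) → ℝ} (ha : a ≠ 0) (b : Fin (n + 1) → ℝ) :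
    tangentOfVec a b
      = tangentMk (ofVec ℝ a) (affineQuotientDeriv (ofVec ℝ a).chartIdx a b) := by
  unfold tangentOfVec tangentMap
  rw [mfderiv_ofVec ha]
  rfl

theorem affineQuotientDeriv_smul_add {i : Fin (n + 1)} {a : Fin (n + 1) → ℝ} (ha : a i ≠ 0)
    (b : Fin (n + 1) → ℝ) {t : ℝ} (ht : t ≠ 0) (k : ℝ) :
    affineQuotientDeriv i (t • a) (t • b + k • a) = affineQuotientDeriv i a b := by
  funext j
  simp only [affineQuotientDeriv_apply, Pi.add_apply, Pi.smul_apply, smul_eq_mul]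
  field_simp
  ring

theorem tangentOfVec_smul_add {a : Fin (n + 1) → ℝ} (ha : a ≠ 0) (b : Fin (n + 1) → ℝ)
    {t : ℝ} (ht : t ≠ 0) (k : ℝ) :
    tangentOfVec (t • a) (t • b + k • a) = tangentOfVec a b := by
  rw [tangentOfVec_eq_tangentMk ha, tangentOfVec_eq_tangentMk (smul_ne_zero ht ha), ofVec_smul ht,
    affineQuotientDeriv_smul_add (apply_chartIdx_ne_zero ha) _ ht]

theorem tangentOfVec_insertNth (p : ProjSpace ℝ n) (v : Fin n → ℝ) :
    tangentOfVec p.affineRep (p.chartIdx.insertNth (0 : ℝ) v : Fin (n + 1) → ℝ)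
      = tangentMk p v := by
  rw [tangentOfVec_eq_tangentMk p.affineRep_ne_zero, ofVec_affineRep]
  congr 1
  funext j
  simp [affineQuotientDeriv_apply, affineRep]

theorem tangentOfVec_tangentLift (q : TRP n) :
    tangentOfVec q.proj.affineRep (q.proj.tangentLift q.snd) = q :=
  tangentOfVec_insertNth q.proj q.snd

/-- The projection is smooth only away from `0`, so the tangent map is taken within this open set,
where it agrees with the unrestricted one. -/
theorem contMDiffAt_tangentOfVec {a : Fin (n + 1) → ℝ} (ha : a ≠ 0) (b : Fin (n + 1) → ℝ) :
    ContMDiffAt 𝓘(ℝ, (Fin (n + 1) → ℝ) × (Fin (n + 1) → ℝ)) 𝓘(ℝ, Fin n → ℝ).tangent ∞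
      (fun x : (Fin (n + 1) → ℝ) × (Fin (n + 1) → ℝ) => tangentOfVec x.1 x.2) (a, b) := by
  have ho : IsOpen {a : Fin (n + 1) → ℝ | a ≠ 0} := isOpen_ne
  have h1 : ContMDiffOn 𝓘(ℝ, Fin (n + 1) → ℝ).tangent 𝓘(ℝ, Fin n → ℝ).tangent ∞
      (tangentMapWithin 𝓘(ℝ, Fin (n + 1) → ℝ) 𝓘(ℝ, Fin n → ℝ) (ofVec ℝ) {a | a ≠ 0}) _ :=
    ContMDiffOn.contMDiffOn_tangentMapWithin
      (fun a ha => (contMDiffAt_ofVec (k := ∞) ha).contMDiffWithinAt) (by simp) ho.uniqueMDiffOn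
  have h2 : ContMDiffAt 𝓘(ℝ, Fin (n + 1) → ℝ).tangent 𝓘(ℝ, Fin n → ℝ).tangent ∞
      (tangentMapWithin 𝓘(ℝ, Fin (n + 1) → ℝ) 𝓘(ℝ, Fin n → ℝ) (ofVec ℝ) {a | a ≠ 0}) ⟨a, b⟩ :=
    h1.contMDiffAt ((ho.preimage (FiberBundle.continuous_proj _ _)).mem_nhds ha)
  have h3 : ContMDiffAt 𝓘(ℝ, (Fin (n + 1) → ℝ) × (Fin (n + 1) → ℝ)) 𝓘(ℝ, Fin (n + 1) → ℝ).tangent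
      ∞ (fun x : (Fin (n + 1) → ℝ) × (Fin (n + 1) → ℝ) =>
        (⟨x.1, x.2⟩ : TangentBundle 𝓘(ℝ, Fin (n + 1) → ℝ) (Fin (n + 1) → ℝ))) (a, b) := by
    have h := contMDiff_tangentBundleModelSpaceHomeomorph_symm (n := ∞)
      (I := 𝓘(ℝ, Fin (n + 1) → ℝ))
    rw [modelWithCornersSelf_prod]
    exact h.contMDiffAt
  refine (h2.comp (a, b) h3).congr_of_eventuallyEq ?_
  filter_upwards [(ho.preimage continuous_fst).mem_nhds (show (a, b).1 ≠ 0 from ha)] with x hx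
  simp only [Function.comp_apply, tangentOfVec, tangentMapWithin, tangentMap,
    mfderivWithin_of_isOpen ho hx]

/-- The inverse chart of the tangent bundle is the tangent map of the inverse affine chart, which
factors as an affine section followed by `[·]`. This transfers computations with pairs `(a, b)` to
charts. -/
theorem extChartAt_tangent_symm_apply (q : TRP n) (y v : Fin n → ℝ) :
    (extChartAt 𝓘(ℝ, Fin n → ℝ).tangent q).symm (y, v)
      = tangentOfVec (q.proj.chartIdx.insertNth (1 : ℝ) y) (q.proj.chartIdx.insertNth (0 : ℝ) v) := by
  have h := tangentMap_chart_symm (I := 𝓘(ℝ, Fin n → ℝ)) (p := q) (q := ⟨y, v⟩) (Set.mem_univ _)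
  have hc : ((affineChart (𝕜 := ℝ) q.proj.chartIdx).symm : (Fin n → ℝ) → ProjSpace ℝ n)
      = ofVec ℝ ∘ fun y => (q.proj.chartIdx.insertNth (1 : ℝ) y : Fin (n + 1) → ℝ) :=
    funext fun y => affineChart_symm_apply _ _
  refine Eq.trans ?_ (h.symm.trans ?_)
  · rfl
  · change tangentMap _ _ ((affineChart (𝕜 := ℝ) q.proj.chartIdx).symm) _ = _
    rw [hc, tangentMap_comp_at (I' := 𝓘(ℝ, Fin (n + 1) → ℝ))]
    · unfold tangentOfVec
      congr 1
      unfold tangentMap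
      simp only [mfderiv_eq_fderiv, (hasFDerivAt_insertNth _ _ _).fderiv]
      rfl
    · exact mdifferentiableAt_ofVec (insertNth_one_ne_zero _ _)
    · exact (hasFDerivAt_insertNth _ _ _).differentiableAt.mdifferentiableAt

theorem extChartAt_tangent_target (q : TRP n) :
    (extChartAt 𝓘(ℝ, Fin n → ℝ).tangent q).target = Set.univ := by
  rw [extChartAt_target]
  refine Set.eq_univ_of_forall fun x => ⟨?_, x, rfl⟩
  exact (TangentBundle.mem_chart_target_iff _ _).2 (Set.mem_univ _)

theorem extChartAt_tangent_self (q : TRP n) :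
    extChartAt 𝓘(ℝ, Fin n → ℝ).tangent q q = (affineCoord q.proj.chartIdx q.proj, q.snd) := by
  have h : (extChartAt 𝓘(ℝ, Fin n → ℝ).tangent q).symm
      (affineCoord q.proj.chartIdx q.proj, q.snd) = q :=
    (extChartAt_tangent_symm_apply q _ _).trans (tangentOfVec_tangentLift q)
  have h' := (extChartAt 𝓘(ℝ, Fin n → ℝ).tangent q).right_inv
    (x := (affineCoord q.proj.chartIdx q.proj, q.snd))
    (by rw [extChartAt_tangent_target]; exact Set.mem_univ _)
  rwa [h] at h'

/-- A map on the tangent bundle of `ℝPⁿ` is smooth where its composition with `tangentOfVec` is. -/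
theorem contMDiffAt_of_comp_tangentOfVec {E' H' N : Type*} [NormedAddCommGroup E']
    [NormedSpace ℝ E'] [TopologicalSpace H'] {J : ModelWithCorners ℝ E' H'} [TopologicalSpace N]
    [ChartedSpace H' N] {f : TRP n → N} {q : TRP n} {k : WithTop ℕ∞}
    (h : ContMDiffAt 𝓘(ℝ, (Fin (n + 1) → ℝ) × (Fin (n + 1) → ℝ)) J k
      (fun x => f (tangentOfVec x.1 x.2)) (q.proj.affineRep, q.proj.tangentLift q.snd)) :
    ContMDiffAt 𝓘(ℝ, Fin n → ℝ).tangent J k f q := by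
  set i := q.proj.chartIdx with hi
  have hx : ContMDiffAt 𝓘(ℝ, Fin n → ℝ).tangent 𝓘(ℝ, (Fin n → ℝ) × (Fin n → ℝ)) k
      (extChartAt 𝓘(ℝ, Fin n → ℝ).tangent q) q := contMDiffAt_extChartAt
  have hs : ContDiff ℝ k (fun x : (Fin n → ℝ) × (Fin n → ℝ) =>
      ((i.insertNth (1 : ℝ) x.1 : Fin (n + 1) → ℝ), (i.insertNth (0 : ℝ) x.2 : Fin (n + 1) → ℝ))) :=
    ((contDiff_insertNth i 1).comp contDiff_fst).prodMk ((contDiff_insertNth i 0).comp contDiff_snd)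
  have hq : (fun x : (Fin n → ℝ) × (Fin n → ℝ) =>
      ((i.insertNth (1 : ℝ) x.1 : Fin (n + 1) → ℝ), (i.insertNth (0 : ℝ) x.2 : Fin (n + 1) → ℝ)))
      (extChartAt 𝓘(ℝ, Fin n → ℝ).tangent q q)
      = (q.proj.affineRep, q.proj.tangentLift q.snd) := by
    rw [extChartAt_tangent_self]
    rfl
  have hc := ContMDiffAt.comp q (f := fun q' => (fun x : (Fin n → ℝ) × (Fin n → ℝ) =>
      ((i.insertNth (1 : ℝ) x.1 : Fin (n + 1) → ℝ), (i.insertNth (0 : ℝ) x.2 : Fin (n + 1) → ℝ)))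
      (extChartAt 𝓘(ℝ, Fin n → ℝ).tangent q q')) (hq ▸ h) (hs.contMDiff.contMDiffAt.comp q hx)
  refine hc.congr_of_eventuallyEq ?_
  filter_upwards [extChartAt_source_mem_nhds (I := 𝓘(ℝ, Fin n → ℝ).tangent) q] with q' hq'
  have := extChartAt_tangent_symm_apply q (extChartAt 𝓘(ℝ, Fin n → ℝ).tangent q q').1
    (extChartAt 𝓘(ℝ, Fin n → ℝ).tangent q q').2
  simp only [Function.comp_apply]
  rw [← this]
  exact congrArg f ((extChartAt _ q).left_inv hq').symm

end TangentOfVec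

/-! ### The map on representatives and the normalization off the quadric -/

section LiftedMap

variable {n : ℕ}

theorem dotProduct_self_pos {a : Fin (n + 1) → ℝ} (ha : a ≠ 0) : 0 < a ⬝ᵥ a := by
  have : 0 ≤ a ⬝ᵥ a := Finset.sum_nonneg fun i _ => mul_self_nonneg (a i)
  exact this.lt_of_ne fun h => ha (dotProduct_self_eq_zero.1 h.symm)

theorem liftedMetric_real (a b b' : Fin (n + 1) → ℝ) :
    liftedMetric a b b'
      = 4 * ((b ⬝ᵥ b') / (a ⬝ᵥ a) - (b ⬝ᵥ a) * (a ⬝ᵥ b') / (a ⬝ᵥ a) ^ 2) := by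
  simp [liftedMetric]

/-- The component of `b` orthogonal to `a`. -/
def orthComponent (a b : Fin (n + 1) → ℝ) : Fin (n + 1) → ℝ := b - ((a ⬝ᵥ b) / (a ⬝ᵥ a)) • a

/-- The square of the cosine of half of `arcsin |v|`, for the tangent vector `v` at `[a]`
represented by `b`. -/
def cosCoeff (a b : Fin (n + 1) → ℝ) : ℝ := (1 + √(1 - liftedMetric a b b)) / 2

/-- The complex vector with real part `x` and imaginary part `y`. -/
def complexVec (x y : Fin (n + 1) → ℝ) : Fin (n + 1) → ℂ := fun k => (x k : ℂ) + y k * Complex.I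

/-- The map between tangent vectors of `ℝⁿ⁺¹ ∖ 0` and `ℂⁿ⁺¹ ∖ 0` which induces the
symplectomorphism. -/
def liftedMap (a b : Fin (n + 1) → ℝ) : Fin (n + 1) → ℂ :=
  complexVec (cosCoeff a b • a) (-orthComponent a b)

theorem dotProduct_orthComponent {a : Fin (n + 1) → ℝ} (ha : a ≠ 0) (b : Fin (n + 1) → ℝ) :
    a ⬝ᵥ orthComponent a b = 0 := by
  have := (dotProduct_self_pos ha).ne'
  simp only [orthComponent, dotProduct_sub, dotProduct_smul, smul_eq_mul]
  field_simp
  ring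

theorem liftedMetric_eq_orthComponent {a : Fin (n + 1) → ℝ} (ha : a ≠ 0) (b : Fin (n + 1) → ℝ) :
    liftedMetric a b b = 4 * (orthComponent a b ⬝ᵥ orthComponent a b) / (a ⬝ᵥ a) := by
  have := (dotProduct_self_pos ha).ne'
  simp only [liftedMetric_real, orthComponent, sub_dotProduct, dotProduct_sub, dotProduct_smul,
    smul_dotProduct, smul_eq_mul, dotProduct_comm b a]
  field_simp
  ring

theorem cosCoeff_pos (a b : Fin (n + 1) → ℝ) : 0 < cosCoeff a b := by
  unfold cosCoeff
  positivity

/-- This is the quadratic equation `c² - c + ρ/4 = 0`, multiplied by `|a|²`. The left side is the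
squared norm of `liftedMap a b`; its value makes `c` cancel in the pullback of `potential`. -/
theorem cosCoeff_sq_mul_add {a b : Fin (n + 1) → ℝ} (ha : a ≠ 0) (h : liftedMetric a b b ≤ 1) :
    cosCoeff a b ^ 2 * (a ⬝ᵥ a) + orthComponent a b ⬝ᵥ orthComponent a b
      = cosCoeff a b * (a ⬝ᵥ a) := by
  have hA := dotProduct_self_pos ha
  have hs := Real.sq_sqrt (sub_nonneg.2 h)
  have hP : orthComponent a b ⬝ᵥ orthComponent a b = liftedMetric a b b * (a ⬝ᵥ a) / 4 := by
    rw [liftedMetric_eq_orthComponent ha]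
    field_simp
  rw [hP]
  unfold cosCoeff
  linear_combination (a ⬝ᵥ a) / 4 * hs

/-- The left side is the sum of squares of the components of `liftedMap a b`; the right side shows
that it is positive exactly while `ρ < 1`. -/
theorem cosCoeff_sq_mul_sub {a b : Fin (n + 1) → ℝ} (ha : a ≠ 0) (h : liftedMetric a b b ≤ 1) :
    cosCoeff a b ^ 2 * (a ⬝ᵥ a) - orthComponent a b ⬝ᵥ orthComponent a b
      = √(1 - liftedMetric a b b) * cosCoeff a b * (a ⬝ᵥ a) := by
  have := cosCoeff_sq_mul_add ha h
  have hc : √(1 - liftedMetric a b b) = 2 * cosCoeff a b - 1 := by unfold cosCoeff; ring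
  rw [hc]
  linear_combination -this

theorem orthComponent_smul_add {a : Fin (n + 1) → ℝ} (ha : a ≠ 0) (b : Fin (n + 1) → ℝ)
    {t : ℝ} (ht : t ≠ 0) (k : ℝ) :
    orthComponent (t • a) (t • b + k • a) = t • orthComponent a b := by
  have := (dotProduct_self_pos ha).ne'
  funext l
  simp only [orthComponent, dotProduct_add, dotProduct_smul, smul_dotProduct, smul_eq_mul,
    Pi.sub_apply, Pi.add_apply, Pi.smul_apply]
  field_simp
  ring

theorem cosCoeff_smul_add {a : Fin (n + 1) → ℝ} (ha : a ≠ 0) (b : Fin (n + 1) → ℝ)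
    {t : ℝ} (ht : t ≠ 0) (k : ℝ) : cosCoeff (t • a) (t • b + k • a) = cosCoeff a b := by
  simp only [cosCoeff, liftedMetric_smul_add ha b b ht]

theorem smul_complexVec (t : ℝ) (x y : Fin (n + 1) → ℝ) :
    (t : ℂ) • complexVec x y = complexVec (t • x) (t • y) := by
  funext l
  simp only [complexVec, Pi.smul_apply, smul_eq_mul, Complex.ofReal_mul]
  ring

/-- Changing the representative of a tangent vector only rescales the image, so the map descends to
the tangent bundle of `ℝPⁿ`. -/
theorem liftedMap_smul_add {a : Fin (n + 1) → ℝ} (ha : a ≠ 0) (b : Fin (n + 1) → ℝ)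
    {t : ℝ} (ht : t ≠ 0) (k : ℝ) :
    liftedMap (t • a) (t • b + k • a) = (t : ℂ) • liftedMap a b := by
  simp only [liftedMap, cosCoeff_smul_add ha b ht, orthComponent_smul_add ha b ht, smul_complexVec,
    smul_neg, smul_comm t]

theorem sum_sq_complexVec (x y : Fin (n + 1) → ℝ) :
    ∑ k, complexVec x y k ^ 2 = ((x ⬝ᵥ x - y ⬝ᵥ y : ℝ) : ℂ) + (2 * (x ⬝ᵥ y) : ℝ) * Complex.I := by
  simp only [dotProduct, complexVec, Complex.ofReal_sub, Complex.ofReal_sum, Complex.ofReal_mul,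
    Finset.mul_sum, Finset.sum_mul, ← Finset.sum_sub_distrib, ← Finset.sum_add_distrib]
  refine Finset.sum_congr rfl fun k _ => ?_
  push_cast
  linear_combination (y k : ℂ) ^ 2 * Complex.I_sq

/-- The sum of the squares of the components is real and positive. -/
def SumSqPos (z : Fin (n + 1) → ℂ) : Prop := ∃ r : ℝ, 0 < r ∧ ∑ k, z k ^ 2 = r

theorem SumSqPos.ne_zero {z : Fin (n + 1) → ℂ} (h : SumSqPos z) : z ≠ 0 := by
  rintro rfl
  obtain ⟨r, hr, h⟩ := h
  simp at h
  exact hr.ne (by exact_mod_cast h)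

theorem sumSqPos_complexVec_iff {x y : Fin (n + 1) → ℝ} :
    SumSqPos (complexVec x y) ↔ y ⬝ᵥ y < x ⬝ᵥ x ∧ x ⬝ᵥ y = 0 := by
  unfold SumSqPos
  rw [sum_sq_complexVec]
  constructor
  · rintro ⟨r, hr, h⟩
    have h1 := congrArg Complex.re h
    have h2 := congrArg Complex.im h
    simp at h1 h2
    exact ⟨by linarith, h2⟩
  · rintro ⟨h1, h2⟩
    exact ⟨x ⬝ᵥ x - y ⬝ᵥ y, by linarith, by simp [h2]⟩

theorem sumSqPos_liftedMap {a b : Fin (n + 1) → ℝ} (ha : a ≠ 0) (h : liftedMetric a b b < 1) :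
    SumSqPos (liftedMap a b) := by
  have h1 := cosCoeff_sq_mul_sub ha h.le
  have h2 : 0 < √(1 - liftedMetric a b b) * cosCoeff a b * (a ⬝ᵥ a) :=
    mul_pos (mul_pos (Real.sqrt_pos.2 (by linarith)) (cosCoeff_pos a b)) (dotProduct_self_pos ha)
  refine sumSqPos_complexVec_iff.2 ⟨?_, ?_⟩
  · simp only [dotProduct_neg, neg_dotProduct, neg_neg, dotProduct_smul, smul_dotProduct,
      smul_eq_mul]
    linarith
  · simp [dotProduct_orthComponent ha]

theorem complexVec_re_im (z : Fin (n + 1) → ℂ) :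
    complexVec (fun k => (z k).re) (fun k => (z k).im) = z :=
  funext fun k => Complex.re_add_im (z k)

/-- Take `μ² = conj (∑ z_k²)`; the sum of squares of `μ z` is then `|∑ z_k²|²`. -/
theorem exists_smul_sumSqPos {z : Fin (n + 1) → ℂ} (hz : ∑ k, z k ^ 2 ≠ 0) :
    ∃ μ : ℂ, μ ≠ 0 ∧ SumSqPos (μ • z) := by
  obtain ⟨μ, hμ⟩ := IsAlgClosed.exists_pow_nat_eq (starRingEnd ℂ (∑ k, z k ^ 2)) two_pos
  refine ⟨μ, fun h => ?_, Complex.normSq (∑ k, z k ^ 2), Complex.normSq_pos.2 hz, ?_⟩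
  · rw [h, zero_pow two_ne_zero] at hμ
    exact hz ((map_eq_zero _).1 hμ.symm)
  · simp only [Pi.smul_apply, smul_eq_mul, mul_pow, ← Finset.mul_sum, hμ]
    rw [mul_comm, Complex.mul_conj]

theorem ofVec_mem_quadric_iff {z : Fin (n + 1) → ℂ} (hz : z ≠ 0) :
    ofVec ℂ z ∈ quadric n ↔ ∑ k, z k ^ 2 = 0 := by
  constructor
  · rintro ⟨w, hw, h, h0⟩
    rw [← ofVec_of_ne_zero hw, ofVec_eq_iff hz hw] at h
    obtain ⟨c, hc, rfl⟩ := h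
    simp [mul_pow, ← Finset.mul_sum, h0]
  · exact fun h => ⟨z, hz, ofVec_of_ne_zero hz, h⟩

theorem SumSqPos.ofVec_notMem_quadric {z : Fin (n + 1) → ℂ} (h : SumSqPos z) :
    ofVec ℂ z ∉ quadric n := by
  rw [ofVec_mem_quadric_iff h.ne_zero]
  obtain ⟨r, hr, h⟩ := h
  rw [h]
  exact_mod_cast hr.ne'

theorem exists_sumSqPos_of_notMem_quadric {p : ProjSpace ℂ n} (hp : p ∉ quadric n) :
    ∃ z, SumSqPos z ∧ ofVec ℂ z = p := by
  rw [← ofVec_rep p, ofVec_mem_quadric_iff p.rep_nonzero] at hp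
  obtain ⟨μ, hμ, h⟩ := exists_smul_sumSqPos hp
  exact ⟨_, h, by rw [ofVec_smul hμ, ofVec_rep]⟩

end LiftedMap

/-! ### Bijectivity onto the complement of the quadric -/

section Diffeo

variable {n : ℕ}

/-- The symplectomorphism from the unit disc bundle of `ℝPⁿ` to the complement of the quadric. -/
def discMap (q : TRP n) : ProjSpace ℂ n :=
  ofVec ℂ (liftedMap q.proj.affineRep (q.proj.tangentLift q.snd))

theorem discMap_tangentOfVec {a : Fin (n + 1) → ℝ} (ha : a ≠ 0) (b : Fin (n + 1) → ℝ) :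
    discMap (tangentOfVec a b) = ofVec ℂ (liftedMap a b) := by
  have ht : (a (ofVec ℝ a).chartIdx)⁻¹ ≠ 0 := inv_ne_zero (apply_chartIdx_ne_zero ha)
  change ofVec ℂ (liftedMap (ofVec ℝ a).affineRep ((ofVec ℝ a).tangentLift
    (mfderiv 𝓘(ℝ, Fin (n + 1) → ℝ) 𝓘(ℝ, Fin n → ℝ) (ofVec ℝ) a b))) = _
  rw [affineRep_ofVec ha, tangentLift_mfderiv_ofVec ha, liftedMap_smul_add ha b ht,
    ofVec_smul (Complex.ofReal_ne_zero.2 ht)]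

theorem tangentOfVec_mem_unitDiscBundle {a : Fin (n + 1) → ℝ} (ha : a ≠ 0)
    (b : Fin (n + 1) → ℝ) : tangentOfVec a b ∈ unitDiscBundle n ↔ liftedMetric a b b < 1 := by
  change metric (ofVec ℝ a) (mfderiv 𝓘(ℝ, Fin (n + 1) → ℝ) 𝓘(ℝ, Fin n → ℝ) (ofVec ℝ) a b)
    (mfderiv 𝓘(ℝ, Fin (n + 1) → ℝ) 𝓘(ℝ, Fin n → ℝ) (ofVec ℝ) a b) < 1 ↔ _
  rw [metric_mfderiv_ofVec ha]

/-- The tangent vector of `ℝPⁿ` which `discMap` takes to `[z]`, for `z` satisfying `SumSqPos`. -/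
def inverseVec (z : Fin (n + 1) → ℂ) : TRP n :=
  tangentOfVec (fun k => (z k).re)
    ((-(((fun k => (z k).re) ⬝ᵥ fun k => (z k).re) / (((fun k => (z k).re) ⬝ᵥ fun k => (z k).re)
      + ((fun k => (z k).im) ⬝ᵥ fun k => (z k).im)))) • fun k => (z k).im)

/-- Origin of the factor: with `a = x`, the vector `c x - i s` is a real multiple of `x + iy` only
if `s = -c y`, and then `c²|x|² + |s|² = c|x|²` forces `c = |x|²/(|x|² + |y|²)`. -/
theorem inverseVec_complexVec (x y : Fin (n + 1) → ℝ) :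
    inverseVec (complexVec x y) = tangentOfVec x ((-((x ⬝ᵥ x) / (x ⬝ᵥ x + y ⬝ᵥ y))) • y) := by
  simp [inverseVec, complexVec]

theorem inverseVec_smul {z : Fin (n + 1) → ℂ} (hz : SumSqPos z) {t : ℝ} (ht : t ≠ 0) :
    inverseVec ((t : ℂ) • z) = inverseVec z := by
  rw [← complexVec_re_im z] at hz ⊢
  set x := fun k => (z k).re
  set y := fun k => (z k).im
  have hx : x ≠ 0 := by
    rintro h
    have := (sumSqPos_complexVec_iff.1 hz).1
    rw [h] at this
    simp only [dotProduct_zero] at this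
    exact this.not_ge (Finset.sum_nonneg fun i _ => mul_self_nonneg (y i))
  rw [smul_complexVec, inverseVec_complexVec, inverseVec_complexVec,
    ← tangentOfVec_smul_add hx _ ht 0]
  congr 1
  simp only [zero_smul, add_zero, smul_dotProduct, dotProduct_smul, smul_eq_mul, smul_smul]
  congr 1
  have hX := dotProduct_self_pos hx
  have hY : 0 ≤ y ⬝ᵥ y := Finset.sum_nonneg fun i _ => mul_self_nonneg (y i)
  have : t * (t * (x ⬝ᵥ x)) + t * (t * (y ⬝ᵥ y)) = t * t * (x ⬝ᵥ x + y ⬝ᵥ y) := by ring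
  rw [this]
  field_simp

open Classical in
/-- The inverse of `discMap`. -/
def discMapInv (p : ProjSpace ℂ n) : TRP n :=
  -- The default value is taken exactly on the quadric.
  if h : ∃ z, SumSqPos z ∧ ofVec ℂ z = p then inverseVec h.choose else tangentOfVec 0 0

/-- Two admissible representatives differ by a scalar whose square is a positive real. Such a scalar
is real, and `inverseVec` is invariant under nonzero real factors. -/
theorem discMapInv_ofVec {z : Fin (n + 1) → ℂ} (hz : SumSqPos z) :
    discMapInv (ofVec ℂ z) = inverseVec z := by
  have h : ∃ w, SumSqPos w ∧ ofVec ℂ w = ofVec ℂ z := ⟨z, hz, rfl⟩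
  unfold discMapInv
  rw [dif_pos h]
  obtain ⟨hw, hwz⟩ := h.choose_spec
  generalize h.choose = w at *
  obtain ⟨c, hc, rfl⟩ := (ofVec_eq_iff hw.ne_zero hz.ne_zero).1 hwz
  obtain ⟨s, hs, hs'⟩ := hw
  obtain ⟨r, hr, hr'⟩ := id hz
  simp only [Pi.smul_apply, smul_eq_mul, mul_pow, ← Finset.mul_sum, hr'] at hs'
  have hi : c.im = 0 := by
    have h1 := congrArg Complex.re hs'
    have h2 := congrArg Complex.im hs'
    simp [pow_two, hr.ne'] at h1 h2
    by_contra hi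
    have hre : c.re = 0 := by
      have : c.re * c.im = 0 := by linarith
      exact (mul_eq_zero.1 this).resolve_right hi
    rw [hre] at h1
    nlinarith [mul_pos (mul_self_pos.2 hi) hr]
  have hcr : (c.re : ℂ) = c := Complex.ext rfl (by simp [hi])
  rw [← hcr]
  exact inverseVec_smul hz fun h => hc (by rw [← hcr, h, Complex.ofReal_zero])

theorem discMapInv_discMap {q : TRP n} (hq : q ∈ unitDiscBundle n) :
    discMapInv (discMap q) = q := by
  have ha := q.proj.affineRep_ne_zero
  have hq1 := tangentOfVec_tangentLift q
  rw [← hq1] at hq ⊢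
  generalize q.proj.affineRep = a at *
  generalize q.proj.tangentLift q.snd = b at *
  rw [tangentOfVec_mem_unitDiscBundle ha] at hq
  rw [discMap_tangentOfVec ha, discMapInv_ofVec (sumSqPos_liftedMap ha hq)]
  have hc := (cosCoeff_pos a b)
  have hA := dotProduct_self_pos ha
  have hid := cosCoeff_sq_mul_add ha hq.le
  unfold liftedMap
  rw [inverseVec_complexVec]
  -- Pass to the representative `(c a, c s)` of the original vector, which is the pair that
  -- `inverseVec` produces once `c²|a|² + |s|² = c|a|²` is inserted.
  have hb : cosCoeff a b • b + (-(cosCoeff a b * ((a ⬝ᵥ b) / (a ⬝ᵥ a)))) • a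
      = cosCoeff a b • orthComponent a b := by
    funext k
    simp only [orthComponent, Pi.add_apply, Pi.sub_apply, Pi.smul_apply, smul_eq_mul]
    ring
  rw [← tangentOfVec_smul_add ha b hc.ne' (-(cosCoeff a b * ((a ⬝ᵥ b) / (a ⬝ᵥ a)))), hb]
  congr 1
  simp only [smul_dotProduct, dotProduct_smul, smul_eq_mul, neg_dotProduct, dotProduct_neg,
    neg_neg, smul_neg, neg_smul]
  congr 1
  rw [← mul_assoc, ← pow_two, hid]
  field_simp

theorem inverseVec_mem_and_discMap {z : Fin (n + 1) → ℂ} (hz : SumSqPos z) :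
    inverseVec z ∈ unitDiscBundle n ∧ discMap (inverseVec z) = ofVec ℂ z := by
  rw [← complexVec_re_im z] at hz ⊢
  generalize (fun k => (z k).re) = x at *
  generalize (fun k => (z k).im) = y at *
  obtain ⟨hxy, h0⟩ := sumSqPos_complexVec_iff.1 hz
  have hY : 0 ≤ y ⬝ᵥ y := Finset.sum_nonneg fun i _ => mul_self_nonneg (y i)
  have hX : 0 < x ⬝ᵥ x := hY.trans_lt hxy
  have hx : x ≠ 0 := fun h => by simp [h] at hX
  have hN : 0 < x ⬝ᵥ x + y ⬝ᵥ y := by linarith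
  set m := (x ⬝ᵥ x) / (x ⬝ᵥ x + y ⬝ᵥ y) with hm
  have hm0 : 0 < m := div_pos hX hN
  have hρ : 1 - liftedMetric x (-m • y) (-m • y)
      = ((x ⬝ᵥ x - y ⬝ᵥ y) / (x ⬝ᵥ x + y ⬝ᵥ y)) ^ 2 := by
    rw [liftedMetric_real]
    simp only [smul_dotProduct, dotProduct_smul, smul_eq_mul, h0, dotProduct_comm y x, hm]
    field_simp
    ring
  -- Here `|y| < |x|` fixes the sign of the square root, so that `m` is the larger root of the
  -- quadratic equation.
  have hc : cosCoeff x (-m • y) = m := by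
    rw [cosCoeff, hρ, Real.sqrt_sq (div_nonneg (by linarith) hN.le), hm]
    field_simp
    ring
  have ho : orthComponent x (-m • y) = -m • y := by simp [orthComponent, h0]
  rw [inverseVec_complexVec, ← hm]
  refine ⟨?_, ?_⟩
  · rw [tangentOfVec_mem_unitDiscBundle hx]
    have : 0 < ((x ⬝ᵥ x - y ⬝ᵥ y) / (x ⬝ᵥ x + y ⬝ᵥ y)) ^ 2 :=
      pow_pos (div_pos (by linarith) hN) 2
    linarith
  · rw [discMap_tangentOfVec hx, liftedMap, hc, ho, neg_smul, neg_neg, ← smul_complexVec,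
      ofVec_smul (Complex.ofReal_ne_zero.2 hm0.ne')]

theorem bijOn_discMap : Set.BijOn (discMap (n := n)) (unitDiscBundle n) (quadric n)ᶜ := by
  refine ⟨fun q hq => ?_, fun q hq q' hq' h => ?_, fun p hp => ?_⟩
  · refine SumSqPos.ofVec_notMem_quadric (sumSqPos_liftedMap q.proj.affineRep_ne_zero ?_)
    rwa [← tangentOfVec_mem_unitDiscBundle q.proj.affineRep_ne_zero, tangentOfVec_tangentLift]
  · rw [← discMapInv_discMap hq, h, discMapInv_discMap hq']
  · obtain ⟨z, hz, rfl⟩ := exists_sumSqPos_of_notMem_quadric hp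
    exact ⟨inverseVec z, inverseVec_mem_and_discMap hz⟩

end Diffeo

/-! ### Smoothness of the map and of its inverse -/

section Smoothness

variable {n : ℕ}

theorem _root_.ContDiffAt.dotProduct {E ι : Type*} [NormedAddCommGroup E] [NormedSpace ℝ E]
    [Fintype ι] {k : WithTop ℕ∞} {f g : E → ι → ℝ} {x : E} (hf : ContDiffAt ℝ k f x)
    (hg : ContDiffAt ℝ k g x) : ContDiffAt ℝ k (fun x => f x ⬝ᵥ g x) x := by
  unfold _root_.dotProduct
  exact ContDiffAt.sum fun i _ => (contDiffAt_pi.1 hf i).mul (contDiffAt_pi.1 hg i)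

theorem contDiffAt_liftedMetric {a : Fin (n + 1) → ℝ} (ha : a ≠ 0) (b : Fin (n + 1) → ℝ)
    {k : WithTop ℕ∞} :
    ContDiffAt ℝ k (fun x : (Fin (n + 1) → ℝ) × (Fin (n + 1) → ℝ) => liftedMetric x.1 x.2 x.2)
      (a, b) := by
  simp only [liftedMetric_real]
  have h1 : ContDiffAt ℝ k (fun x : (Fin (n + 1) → ℝ) × (Fin (n + 1) → ℝ) => x.1) (a, b) :=
    contDiffAt_fst
  have h2 : ContDiffAt ℝ k (fun x : (Fin (n + 1) → ℝ) × (Fin (n + 1) → ℝ) => x.2) (a, b) :=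
    contDiffAt_snd
  have hA := (dotProduct_self_pos ha).ne'
  exact contDiffAt_const.mul (((h2.dotProduct h2).div (h1.dotProduct h1) hA).sub
    (((h2.dotProduct h1).mul (h1.dotProduct h2)).div ((h1.dotProduct h1).pow 2) (pow_ne_zero 2 hA)))

theorem contDiffAt_orthComponent {a : Fin (n + 1) → ℝ} (ha : a ≠ 0) (b : Fin (n + 1) → ℝ)
    {k : WithTop ℕ∞} :
    ContDiffAt ℝ k (fun x : (Fin (n + 1) → ℝ) × (Fin (n + 1) → ℝ) => orthComponent x.1 x.2)
      (a, b) := by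
  have h1 : ContDiffAt ℝ k (fun x : (Fin (n + 1) → ℝ) × (Fin (n + 1) → ℝ) => x.1) (a, b) :=
    contDiffAt_fst
  have h2 : ContDiffAt ℝ k (fun x : (Fin (n + 1) → ℝ) × (Fin (n + 1) → ℝ) => x.2) (a, b) :=
    contDiffAt_snd
  exact h2.sub (((h1.dotProduct h2).div (h1.dotProduct h1) (dotProduct_self_pos ha).ne').smul h1)

/-- The root is taken of `1 - |v|²`, which is positive on the open disc bundle. Since only `|v|²`
enters, the zero section needs no separate treatment. -/
theorem contDiffAt_cosCoeff {a b : Fin (n + 1) → ℝ} (ha : a ≠ 0) (h : liftedMetric a b b < 1)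
    {k : WithTop ℕ∞} :
    ContDiffAt ℝ k (fun x : (Fin (n + 1) → ℝ) × (Fin (n + 1) → ℝ) => cosCoeff x.1 x.2)
      (a, b) := by
  unfold cosCoeff
  refine (contDiffAt_const.add (ContDiffAt.sqrt ?_ ?_)).div_const 2
  · exact contDiffAt_const.sub (contDiffAt_liftedMetric ha b)
  · exact (sub_pos.2 h).ne'

theorem contDiff_complexVec {k : WithTop ℕ∞} :
    ContDiff ℝ k (fun x : (Fin (n + 1) → ℝ) × (Fin (n + 1) → ℝ) => complexVec x.1 x.2) := by
  refine contDiff_pi.2 fun l => ?_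
  unfold complexVec
  refine ContDiff.add ?_ (ContDiff.mul ?_ contDiff_const)
  · exact Complex.ofRealCLM.contDiff.comp ((contDiff_apply ℝ ℝ l).comp contDiff_fst)
  · exact Complex.ofRealCLM.contDiff.comp ((contDiff_apply ℝ ℝ l).comp contDiff_snd)

theorem contDiffAt_liftedMap {a b : Fin (n + 1) → ℝ} (ha : a ≠ 0) (h : liftedMetric a b b < 1)
    {k : WithTop ℕ∞} :
    ContDiffAt ℝ k (fun x : (Fin (n + 1) → ℝ) × (Fin (n + 1) → ℝ) => liftedMap x.1 x.2)
      (a, b) :=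
  contDiff_complexVec.contDiffAt.comp (a, b)
    (((contDiffAt_cosCoeff ha h).smul contDiffAt_fst).prodMk (contDiffAt_orthComponent ha b).neg)

theorem eventually_discMap_tangentOfVec {a : Fin (n + 1) → ℝ} (ha : a ≠ 0)
    (b : Fin (n + 1) → ℝ) :
    (fun x : (Fin (n + 1) → ℝ) × (Fin (n + 1) → ℝ) => discMap (tangentOfVec x.1 x.2))
      =ᶠ[𝓝 (a, b)] fun x => ofVec ℂ (liftedMap x.1 x.2) := by
  filter_upwards [(isOpen_ne.preimage continuous_fst).mem_nhds (show (a, b).1 ≠ 0 from ha)]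
    with x hx
  exact discMap_tangentOfVec hx _

theorem liftedMetric_tangentLift_lt_one {q : TRP n} (hq : q ∈ unitDiscBundle n) :
    liftedMetric q.proj.affineRep (q.proj.tangentLift q.snd) (q.proj.tangentLift q.snd) < 1 := hq

theorem contMDiffAt_discMap {q : TRP n} (hq : q ∈ unitDiscBundle n) :
    ContMDiffAt 𝓘(ℝ, Fin n → ℝ).tangent 𝓘(ℝ, Fin n → ℂ) ∞ discMap q := by
  have ha := q.proj.affineRep_ne_zero
  have hq' := liftedMetric_tangentLift_lt_one hq
  refine contMDiffAt_of_comp_tangentOfVec ?_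
  refine ContMDiffAt.congr_of_eventuallyEq ?_ (eventually_discMap_tangentOfVec ha _)
  exact ContMDiffAt.comp (q.proj.affineRep, q.proj.tangentLift q.snd)
    (contMDiffAt_ofVec (sumSqPos_liftedMap ha hq').ne_zero)
    (contDiffAt_liftedMap ha hq').contMDiffAt

theorem isOpen_unitDiscBundle : IsOpen (unitDiscBundle n) := by
  have h : Continuous fun q : TRP n => metric q.proj q.snd q.snd := by
    refine continuous_iff_continuousAt.2 fun q => ?_
    have hc : ContMDiffAt 𝓘(ℝ, Fin n → ℝ).tangent 𝓘(ℝ, ℝ) ∞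
        (fun q : TRP n => metric q.proj q.snd q.snd) q := by
      have ha := q.proj.affineRep_ne_zero
      refine contMDiffAt_of_comp_tangentOfVec ?_
      refine ContMDiffAt.congr_of_eventuallyEq (contDiffAt_liftedMetric ha _).contMDiffAt ?_
      filter_upwards [(isOpen_ne.preimage continuous_fst).mem_nhds
        (show (q.proj.affineRep, q.proj.tangentLift q.snd).1 ≠ 0 from ha)] with x hx
      exact metric_mfderiv_ofVec hx _ _
    exact hc.continuousAt
  exact isOpen_lt h continuous_const

theorem isOpen_compl_quadric : IsOpen (quadric n)ᶜ := by
  rw [isOpen_coinduced]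
  have : Projectivization.mk' ℂ ⁻¹' (quadric n)ᶜ
      = {v : {v : Fin (n + 1) → ℂ // v ≠ 0} | ∑ k, v.1 k ^ 2 ≠ 0} := by
    ext v
    rw [Set.mem_preimage, Projectivization.mk'_eq_mk, ← ofVec_of_ne_zero, Set.mem_compl_iff,
      ofVec_mem_quadric_iff v.2]
    rfl
  rw [this]
  exact isOpen_ne_fun (continuous_finsetSum _ fun k _ =>
    ((continuous_apply k).comp continuous_subtype_val).pow 2) continuous_const

theorem contMDiffAt_inverseVec {z : Fin (n + 1) → ℂ} (hz : SumSqPos z) :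
    ContMDiffAt 𝓘(ℝ, Fin (n + 1) → ℂ) 𝓘(ℝ, Fin n → ℝ).tangent ∞ (inverseVec (n := n)) z := by
  have hre : ContDiffAt ℝ ∞ (fun (z : Fin (n + 1) → ℂ) (k : Fin (n + 1)) => (z k).re) z :=
    contDiffAt_pi.2 fun k =>
      (Complex.reCLM.contDiff.comp (contDiff_apply ℝ ℂ k)).contDiffAt
  have him : ContDiffAt ℝ ∞ (fun (z : Fin (n + 1) → ℂ) (k : Fin (n + 1)) => (z k).im) z :=
    contDiffAt_pi.2 fun k =>
      (Complex.imCLM.contDiff.comp (contDiff_apply ℝ ℂ k)).contDiffAt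
  have hxy := (sumSqPos_complexVec_iff.1 ((complexVec_re_im z).symm ▸ hz)).1
  have hY : 0 ≤ (fun k => (z k).im) ⬝ᵥ fun k => (z k).im :=
    Finset.sum_nonneg fun i _ => mul_self_nonneg _
  have hx : (fun k => (z k).re) ≠ 0 := by
    intro h
    rw [h, dotProduct_zero] at hxy
    exact hxy.not_ge hY
  refine ContMDiffAt.comp z
    (g := fun x : (Fin (n + 1) → ℝ) × (Fin (n + 1) → ℝ) => tangentOfVec x.1 x.2)
    (f := fun z : Fin (n + 1) → ℂ => ((fun k => (z k).re), (-(((fun k => (z k).re) ⬝ᵥ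
      fun k => (z k).re) / (((fun k => (z k).re) ⬝ᵥ fun k => (z k).re)
      + ((fun k => (z k).im) ⬝ᵥ fun k => (z k).im)))) • fun k => (z k).im))
    (contMDiffAt_tangentOfVec hx _) (ContDiffAt.contMDiffAt ?_)
  have hc := ((hre.dotProduct hre).div ((hre.dotProduct hre).add (him.dotProduct him))
    (by linarith)).neg
  exact hre.prodMk (hc.smul him)

/-- A scalar `ν` for which `SumSqPos (ν • z)` holds for all `z` close to vectors which satisfy
`SumSqPos`. -/
def phaseCorrection (z : Fin (n + 1) → ℂ) : ℂ :=
  starRingEnd ℂ (∑ k, z k ^ 2) + (‖∑ k, z k ^ 2‖ : ℂ)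

/-- With `q = ∑ z_k²` and `ν = conj q + |q|` one has `ν² q = |q|² (2|q| + 2 Re q)`. Thus `ν` points
along a square root of `conj q` and is smooth in `q ≠ 0`, without a choice of branch. -/
theorem sumSqPos_phaseCorrection_smul {z : Fin (n + 1) → ℂ} (hz : 0 < (∑ k, z k ^ 2).re) :
    phaseCorrection z ≠ 0 ∧ SumSqPos (phaseCorrection z • z) := by
  unfold phaseCorrection SumSqPos
  simp only [Pi.smul_apply, smul_eq_mul, mul_pow, ← Finset.mul_sum]
  generalize ∑ k, z k ^ 2 = q at *
  have hq : 0 < ‖q‖ := norm_pos_iff.2 fun h => by simp [h] at hz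
  refine ⟨fun h => ?_, ‖q‖ ^ 2 * (2 * ‖q‖ + 2 * q.re), by positivity, ?_⟩
  · have := congrArg Complex.re h
    simp at this
    linarith
  · have h1 := Complex.mul_conj' q
    have h2 := Complex.add_conj q
    push_cast at h2 ⊢
    linear_combination (starRingEnd ℂ q + 2 * ‖q‖) * h1 + (‖q‖ : ℂ) ^ 2 * h2

theorem contDiff_sum_sq {k : WithTop ℕ∞} :
    ContDiff ℝ k (fun z : Fin (n + 1) → ℂ => ∑ l, z l ^ 2) :=
  ContDiff.sum fun l _ => (contDiff_apply ℝ ℂ l).pow 2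

theorem contDiffAt_phaseCorrection {z : Fin (n + 1) → ℂ} (hz : ∑ k, z k ^ 2 ≠ 0)
    {k : WithTop ℕ∞} : ContDiffAt ℝ k (phaseCorrection (n := n)) z :=
  (Complex.conjCLE.contDiff.comp contDiff_sum_sq).contDiffAt.add
    (Complex.ofRealCLM.contDiff.contDiffAt.comp z (contDiff_sum_sq.contDiffAt.norm ℝ hz))

theorem contMDiffAt_discMapInv {p : ProjSpace ℂ n} (hp : p ∉ quadric n) :
    ContMDiffAt 𝓘(ℝ, Fin n → ℂ) 𝓘(ℝ, Fin n → ℝ).tangent ∞ discMapInv p := by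
  refine contMDiffAt_of_comp_ofVec ?_
  rw [← ofVec_affineRep p, ofVec_mem_quadric_iff p.affineRep_ne_zero] at hp
  generalize p.affineRep = z at *
  -- The constant `μ` normalizes only the base point. It brings nearby sums of squares into the
  -- right half plane, where `phaseCorrection` normalizes them smoothly.
  obtain ⟨μ, hμ, hz⟩ := exists_smul_sumSqPos hp
  have hre : 0 < (∑ k, (μ • z) k ^ 2).re := by
    obtain ⟨r, hr, h⟩ := hz
    rw [h]
    exact_mod_cast hr
  have hsm : ContDiff ℝ ∞ fun w : Fin (n + 1) → ℂ => μ • w := contDiff_const_smul μ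
  have hd : ContDiffAt ℝ ∞ (fun w : Fin (n + 1) → ℂ => phaseCorrection (μ • w) • (μ • w)) z := by
    refine ContDiffAt.smul (ContDiffAt.comp z (contDiffAt_phaseCorrection ?_) hsm.contDiffAt)
      hsm.contDiffAt
    exact fun h => hre.ne' (by rw [h, Complex.zero_re])
  refine (ContMDiffAt.comp z (g := inverseVec)
    (f := fun w : Fin (n + 1) → ℂ => phaseCorrection (μ • w) • (μ • w))
    (contMDiffAt_inverseVec (sumSqPos_phaseCorrection_smul hre).2)
    hd.contMDiffAt).congr_of_eventuallyEq ?_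
  have ho : IsOpen {w : Fin (n + 1) → ℂ | 0 < (∑ k, (μ • w) k ^ 2).re} :=
    isOpen_lt continuous_const
      (Complex.continuous_re.comp ((contDiff_sum_sq (k := 0)).continuous.comp hsm.continuous))
  filter_upwards [ho.mem_nhds hre] with w hw
  obtain ⟨h1, h2⟩ := sumSqPos_phaseCorrection_smul hw
  simp only [Function.comp_apply]
  rw [← discMapInv_ofVec h2, ofVec_smul h1, ofVec_smul hμ]

theorem isDiffeoOnto_discMap :
    IsDiffeoOnto 𝓘(ℝ, Fin n → ℝ).tangent 𝓘(ℝ, Fin n → ℂ) (discMap (n := n))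
      (unitDiscBundle n) (quadric n)ᶜ where
  isOpen_source := isOpen_unitDiscBundle
  isOpen_target := isOpen_compl_quadric
  bijOn := bijOn_discMap
  contMDiffOn _ hq := (contMDiffAt_discMap hq).contMDiffWithinAt
  exists_inverse := ⟨discMapInv, fun _ hp => (contMDiffAt_discMapInv hp).contMDiffWithinAt,
    fun _ hq => discMapInv_discMap hq⟩

end Smoothness

/-! ### Equivariance under rotations, and the explicit formula -/

section Equivariance

variable {n : ℕ}

theorem rotate_ofVec {𝕜 : Type*} [RCLike 𝕜] (A : Matrix.specialOrthogonalGroup (Fin (n + 1)) ℝ)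
    {z : Fin (n + 1) → 𝕜} (hz : z ≠ 0) :
    rotate 𝕜 A (ofVec 𝕜 z) = ofVec 𝕜 ((A.1.map (algebraMap ℝ 𝕜)).mulVec z) := by
  have h : (A.1.map (algebraMap ℝ 𝕜)).mulVec z ≠ 0 := fun h =>
    hz (mulVecLin_injective 𝕜 A (by simpa using h))
  rw [ofVec_of_ne_zero hz, ofVec_of_ne_zero h]
  rfl

theorem dotProduct_mulVec_specialOrthogonal (A : Matrix.specialOrthogonalGroup (Fin (n + 1)) ℝ)
    (x y : Fin (n + 1) → ℝ) : A.1.mulVec x ⬝ᵥ A.1.mulVec y = x ⬝ᵥ y := by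
  have h : A.1.transpose * A.1 = 1 :=
    (Matrix.mem_orthogonalGroup_iff' _ _).1 (Matrix.mem_specialOrthogonalGroup_iff.1 A.2).1
  rw [Matrix.dotProduct_mulVec, Matrix.vecMul_mulVec, h, Matrix.vecMul_one]

theorem _root_.Filter.EventuallyEq.tangentMap_eq {E H M E' H' M' : Type*} [NormedAddCommGroup E]
    [NormedSpace ℝ E] [TopologicalSpace H] {I : ModelWithCorners ℝ E H} [TopologicalSpace M]
    [ChartedSpace H M] [NormedAddCommGroup E'] [NormedSpace ℝ E'] [TopologicalSpace H']
    {I' : ModelWithCorners ℝ E' H'} [TopologicalSpace M'] [ChartedSpace H' M'] {f g : M → M'}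
    {x : TangentBundle I M} (h : f =ᶠ[𝓝 x.1] g) : tangentMap I I' f x = tangentMap I I' g x := by
  unfold tangentMap
  rw [h.mfderiv_eq]
  congr 1
  exact h.eq_of_nhds

theorem mulVec_ne_zero (A : Matrix.specialOrthogonalGroup (Fin (n + 1)) ℝ)
    {a : Fin (n + 1) → ℝ} (ha : a ≠ 0) : A.1.mulVec a ≠ 0 := fun h => by
  have := dotProduct_mulVec_specialOrthogonal A a a
  rw [h, dotProduct_zero] at this
  exact (dotProduct_self_pos ha).ne this

/-- Differentiate `rotate A ∘ [·] = [·] ∘ A`, which holds away from the origin. -/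
theorem rotateTangent_tangentOfVec (A : Matrix.specialOrthogonalGroup (Fin (n + 1)) ℝ)
    {a : Fin (n + 1) → ℝ} (ha : a ≠ 0) (b : Fin (n + 1) → ℝ) :
    rotateTangent A (tangentOfVec a b) = tangentOfVec (A.1.mulVec a) (A.1.mulVec b) := by
  have hd (x : Fin (n + 1) → ℝ) := (A.1.mulVecLin.toContinuousLinearMap).hasFDerivAt (x := x)
  have hev (x : Fin (n + 1) → ℝ) (hx : x ≠ 0) : rotate ℝ A ∘ ofVec ℝ
      =ᶠ[𝓝 x] ofVec ℝ ∘ A.1.mulVecLin.toContinuousLinearMap := by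
    filter_upwards [isOpen_ne.mem_nhds hx] with y hy
    simp only [Function.comp_apply]
    rw [rotate_ofVec A hy]
    rfl
  have hA : MDifferentiableAt 𝓘(ℝ, Fin n → ℝ) 𝓘(ℝ, Fin n → ℝ) (rotate ℝ A) (ofVec ℝ a) := by
    have h0 := (ofVec ℝ a).affineRep_ne_zero
    refine ContMDiffAt.mdifferentiableAt (n := 1) (contMDiffAt_of_comp_ofVec ?_) one_ne_zero
    refine ContMDiffAt.congr_of_eventuallyEq ?_ (hev _ h0)
    exact ContMDiffAt.comp _ (contMDiffAt_ofVec (mulVec_ne_zero A h0))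
      (A.1.mulVecLin.toContinuousLinearMap.contDiff.contMDiff.contMDiffAt)
  unfold rotateTangent tangentOfVec
  rw [← tangentMap_comp_at _ hA (mdifferentiableAt_ofVec ha), (hev a ha).tangentMap_eq]
  refine (tangentMap_comp_at (I' := 𝓘(ℝ, Fin (n + 1) → ℝ))
    (f := A.1.mulVecLin.toContinuousLinearMap) _ (mdifferentiableAt_ofVec (mulVec_ne_zero A ha))
    (hd _).differentiableAt.mdifferentiableAt).trans ?_
  congr 1
  unfold tangentMap
  simp only [mfderiv_eq_fderiv, (hd _).fderiv]
  rfl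

theorem liftedMap_mulVec (A : Matrix.specialOrthogonalGroup (Fin (n + 1)) ℝ)
    (a b : Fin (n + 1) → ℝ) :
    liftedMap (A.1.mulVec a) (A.1.mulVec b)
      = (A.1.map (algebraMap ℝ ℂ)).mulVec (liftedMap a b) := by
  have hc : cosCoeff (A.1.mulVec a) (A.1.mulVec b) = cosCoeff a b := by
    simp only [cosCoeff, liftedMetric_real, dotProduct_mulVec_specialOrthogonal]
  have ho : orthComponent (A.1.mulVec a) (A.1.mulVec b) = A.1.mulVec (orthComponent a b) := by
    simp only [orthComponent, dotProduct_mulVec_specialOrthogonal, Matrix.mulVec_sub,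
      Matrix.mulVec_smul]
  have hm (x y : Fin (n + 1) → ℝ) : complexVec (A.1.mulVec x) (A.1.mulVec y)
      = (A.1.map (algebraMap ℝ ℂ)).mulVec (complexVec x y) := by
    funext k
    simp only [complexVec, Matrix.mulVec, dotProduct, Complex.ofReal_sum, Complex.ofReal_mul,
      Matrix.map_apply, Complex.coe_algebraMap, mul_add, Finset.sum_add_distrib, Finset.sum_mul,
      mul_assoc]
  rw [liftedMap, hc, ho, ← Matrix.mulVec_smul, ← Matrix.mulVec_neg, hm, liftedMap]

theorem discMap_rotateTangent (A : Matrix.specialOrthogonalGroup (Fin (n + 1)) ℝ) {q : TRP n}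
    (hq : q ∈ unitDiscBundle n) : rotateTangent A q ∈ unitDiscBundle n ∧
      discMap (rotateTangent A q) = rotate ℂ A (discMap q) := by
  have ha := q.proj.affineRep_ne_zero
  rw [← tangentOfVec_tangentLift q] at hq ⊢
  generalize q.proj.affineRep = a at *
  generalize q.proj.tangentLift q.snd = b at *
  have hAa := mulVec_ne_zero A ha
  rw [tangentOfVec_mem_unitDiscBundle ha] at hq
  rw [rotateTangent_tangentOfVec A ha, tangentOfVec_mem_unitDiscBundle hAa,
    discMap_tangentOfVec ha, discMap_tangentOfVec hAa,
    rotate_ofVec A (sumSqPos_liftedMap ha hq).ne_zero, liftedMap_mulVec]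
  refine ⟨?_, rfl⟩
  simpa only [liftedMetric_real, dotProduct_mulVec_specialOrthogonal] using hq

end Equivariance

/-- The explicit form of `discMap`. -/
theorem discMap_tangentOfVec_orthonormal {n : ℕ} {u w : Fin (n + 1) → ℝ} (hu : u ⬝ᵥ u = 1)
    (hw : w ⬝ᵥ w = 1) (huw : u ⬝ᵥ w = 0) {r : ℝ} (hr : 0 ≤ r) (hr' : r < 1) :
    discMap (tangentOfVec u ((r / 2) • w)) = ofVec ℂ (fun k =>
      (Real.cos (Real.arcsin r / 2) * u k : ℂ)
        - Complex.I * (Real.sin (Real.arcsin r / 2) * w k)) := by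
  have hu0 : u ≠ 0 := fun h => by simp [h] at hu
  set θ := Real.arcsin r / 2 with hθ
  have hpos : 0 < Real.cos θ := by
    have h1 := Real.arcsin_nonneg.2 hr
    have h2 := Real.arcsin_le_pi_div_two r
    exact Real.cos_pos_of_mem_Ioo ⟨by linarith [Real.pi_pos], by linarith [Real.pi_pos]⟩
  -- From `r = sin 2θ`.
  have hsin : r / 2 = Real.sin θ * Real.cos θ := by
    have := Real.sin_two_mul θ
    rw [hθ, mul_div_cancel₀ _ two_ne_zero, Real.sin_arcsin (by linarith) hr'.le, ← hθ] at this
    linarith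
  have hρ : 1 - liftedMetric u ((r / 2) • w) ((r / 2) • w) = 1 - r ^ 2 := by
    rw [liftedMetric_real]
    simp only [smul_dotProduct, dotProduct_smul, smul_eq_mul, hu, hw, huw, dotProduct_comm w u]
    ring
  have hc : cosCoeff u ((r / 2) • w) = Real.cos θ ^ 2 := by
    rw [cosCoeff, hρ, ← Real.cos_arcsin, Real.cos_sq, hθ, mul_div_cancel₀ _ two_ne_zero]
    ring
  have ho : orthComponent u ((r / 2) • w) = (r / 2) • w := by simp [orthComponent, huw]
  rw [discMap_tangentOfVec hu0, liftedMap, hc, ho, hsin]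
  -- The lifted vector is `cos θ` times the asserted one.
  refine Eq.trans ?_ (ofVec_smul (Complex.ofReal_ne_zero.2 hpos.ne') _)
  congr 1
  funext k
  simp only [ complexVec, Pi.smul_apply, Pi.neg_apply, smul_eq_mul]
  push_cast
  ring

/-! ### A primitive of the lifted Fubini-Study form -/

section Potential

variable {n : ℕ}

/-- The linear form `Im ⟨z, ·⟩`. -/
def imForm (z : Fin (n + 1) → ℂ) : (Fin (n + 1) → ℂ) →L[ℝ] ℝ :=
  ∑ k, ((z k).re • Complex.imCLM.comp (ContinuousLinearMap.proj (R := ℝ) k)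
    - (z k).im • Complex.reCLM.comp (ContinuousLinearMap.proj (R := ℝ) k))

theorem imForm_apply (z η : Fin (n + 1) → ℂ) : imForm z η = (star z ⬝ᵥ η).im := by
  simp only [imForm, sum_apply, dotProduct, Complex.im_sum]
  refine Finset.sum_congr rfl fun k _ => ?_
  simp
  ring

/-- A primitive of the pullback of the Fubini-Study form to `ℂⁿ⁺¹ ∖ 0`. -/
def potential (z : Fin (n + 1) → ℂ) : (Fin (n + 1) → ℂ) →L[ℝ] ℝ :=
  (2 / (star z ⬝ᵥ z).re) • imForm z

/-- `potential` as a differential form. -/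
def potentialForm (z : Fin (n + 1) → ℂ) : (Fin (n + 1) → ℂ) [⋀^Fin 1]→L[ℝ] ℝ :=
  ContinuousAlternatingMap.ofSubsingleton ℝ _ ℝ (0 : Fin 1) (potential z)

theorem star_dotProduct_complexVec (x y x' y' : Fin (n + 1) → ℝ) :
    star (complexVec x y) ⬝ᵥ complexVec x' y'
      = ((x ⬝ᵥ x' + y ⬝ᵥ y' : ℝ) : ℂ) + ((x ⬝ᵥ y' - y ⬝ᵥ x' : ℝ) : ℂ) * Complex.I := by
  simp only [dotProduct, complexVec, Complex.ofReal_sub, Complex.ofReal_add, Complex.ofReal_sum,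
    Complex.ofReal_mul, Finset.sum_mul, ← Finset.sum_sub_distrib, ← Finset.sum_add_distrib,
    Pi.star_apply, star_add, star_mul', Complex.star_def, Complex.conj_ofReal, Complex.conj_I]
  refine Finset.sum_congr rfl fun k _ => ?_
  linear_combination (-(y k : ℂ) * y' k) * Complex.I_sq

theorem star_dotProduct_self_eq (z : Fin (n + 1) → ℂ) :
    star z ⬝ᵥ z = ((star z ⬝ᵥ z).re : ℂ) := by
  rw [← complexVec_re_im z, star_dotProduct_complexVec]
  simp [dotProduct_comm]

theorem re_star_dotProduct_self_pos {z : Fin (n + 1) → ℂ} (hz : z ≠ 0) :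
    0 < (star z ⬝ᵥ z).re := by
  have h : 0 ≤ (star z ⬝ᵥ z).re := by
    rw [dotProduct, Complex.re_sum]
    refine Finset.sum_nonneg fun k _ => ?_
    simp
    nlinarith [mul_self_nonneg (z k).re, mul_self_nonneg (z k).im]
  refine h.lt_of_ne fun h0 => star_dotProduct_self_ne_zero hz ?_
  rw [star_dotProduct_self_eq, ← h0, Complex.ofReal_zero]

/-- The first slot is conjugated, so `i` enters as `-i` and `Re (-i w) = Im w`. -/
theorem liftedMetric_I_smul (z ξ η : Fin (n + 1) → ℂ) :
    liftedMetric z (Complex.I • ξ) η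
      = 4 * ((star ξ ⬝ᵥ η).im / (star z ⬝ᵥ z).re
        - ((star z ⬝ᵥ ξ).re * (star z ⬝ᵥ η).im - (star z ⬝ᵥ η).re * (star z ⬝ᵥ ξ).im)
          / (star z ⬝ᵥ z).re ^ 2) := by
  have hs : star ξ ⬝ᵥ z = starRingEnd ℂ (star z ⬝ᵥ ξ) := by
    rw [← Complex.star_def, Matrix.star_dotProduct]
  unfold liftedMetric
  rw [star_dotProduct_self_eq z]
  simp only [star_smul, smul_dotProduct, hs, smul_eq_mul, ← Complex.ofReal_pow]
  rw [map_sub]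
  simp only [RCLike.re_eq_complex_re, Complex.div_ofReal_re]
  simp
  ring

theorem contDiff_re_star_dotProduct_self {k : WithTop ℕ∞} :
    ContDiff ℝ k (fun z : Fin (n + 1) → ℂ => (star z ⬝ᵥ z).re) := by
  refine Complex.reCLM.contDiff.comp (ContDiff.sum fun l _ => ?_)
  exact (Complex.conjCLE.contDiff.comp (contDiff_apply ℝ ℂ l)).mul (contDiff_apply ℝ ℂ l)

theorem contDiff_imForm {k : WithTop ℕ∞} : ContDiff ℝ k (imForm (n := n)) := by
  refine ContDiff.sum fun l _ => ContDiff.sub ?_ ?_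
  · exact (Complex.reCLM.contDiff.comp (contDiff_apply ℝ ℂ l)).smul contDiff_const
  · exact (Complex.imCLM.contDiff.comp (contDiff_apply ℝ ℂ l)).smul contDiff_const

theorem differentiableAt_potential {z : Fin (n + 1) → ℂ} (hz : z ≠ 0) :
    DifferentiableAt ℝ (potential (n := n)) z :=
  ((contDiffAt_const.div contDiff_re_star_dotProduct_self.contDiffAt
    (re_star_dotProduct_self_pos hz).ne').smul
    (contDiff_imForm (k := 1)).contDiffAt).differentiableAt one_ne_zero

theorem differentiableAt_potentialForm {z : Fin (n + 1) → ℂ} (hz : z ≠ 0) :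
    DifferentiableAt ℝ (potentialForm (n := n)) z := by
  let L : ((Fin (n + 1) → ℂ) →L[ℝ] ℝ) →ₗ[ℝ] (Fin (n + 1) → ℂ) [⋀^Fin 1]→L[ℝ] ℝ :=
    { toFun := ContinuousAlternatingMap.ofSubsingleton ℝ _ ℝ (0 : Fin 1)
      map_add' := fun _ _ => rfl
      map_smul' := fun _ _ => rfl }
  exact (LinearMap.toContinuousLinearMap L).differentiableAt.comp z (differentiableAt_potential hz)

theorem fderiv_potential_apply {z : Fin (n + 1) → ℂ} (hz : z ≠ 0) (ξ η : Fin (n + 1) → ℂ) :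
    fderiv ℝ (fun z => potential z η) z ξ
      = 2 * (star ξ ⬝ᵥ η).im / (star z ⬝ᵥ z).re
        - 4 * (star z ⬝ᵥ η).im * (star z ⬝ᵥ ξ).re / (star z ⬝ᵥ z).re ^ 2 := by
  have hN := (re_star_dotProduct_self_pos hz).ne'
  have hd : DifferentiableAt ℝ (fun z => potential z η) z :=
    (differentiableAt_potential hz).clm_apply (differentiableAt_const η)
  rw [← hd.lineDeriv_eq_fderiv]
  have hs : (star ξ ⬝ᵥ z).re = (star z ⬝ᵥ ξ).re := by
    have : star ξ ⬝ᵥ z = starRingEnd ℂ (star z ⬝ᵥ ξ) := by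
      rw [← Complex.star_def, Matrix.star_dotProduct]
    rw [this, Complex.conj_re]
  -- Along the line `z + tξ` the potential is an affine function of `t` divided by a quadratic one,
  -- so only a one-variable derivative at `0` remains.
  have hf : (fun t : ℝ => potential (z + t • ξ) η)
      = fun t : ℝ => 2 / ((star z ⬝ᵥ z).re + t * (2 * (star z ⬝ᵥ ξ).re)
        + t ^ 2 * (star ξ ⬝ᵥ ξ).re) * ((star z ⬝ᵥ η).im + t * (star ξ ⬝ᵥ η).im) := by
    funext t
    have hr (x y : Fin (n + 1) → ℂ) : star (t • x) ⬝ᵥ y = (t : ℂ) * (star x ⬝ᵥ y) := by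
      rw [star_smul, star_trivial, smul_dotProduct, Complex.real_smul]
    have hr' (x y : Fin (n + 1) → ℂ) : x ⬝ᵥ (t • y) = (t : ℂ) * (x ⬝ᵥ y) := by
      rw [dotProduct_smul, Complex.real_smul]
    simp only [potential, smul_apply, imForm_apply, star_add, add_dotProduct,
      dotProduct_add, hr, hr', Complex.add_im, Complex.add_re, Complex.re_ofReal_mul,
      Complex.im_ofReal_mul, smul_eq_mul, hs]
    congr 2
    ring
  have h1 : HasDerivAt (fun t : ℝ => (star z ⬝ᵥ z).re + t * (2 * (star z ⬝ᵥ ξ).re)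
      + t ^ 2 * (star ξ ⬝ᵥ ξ).re) (2 * (star z ⬝ᵥ ξ).re) 0 := by
    have := (((hasDerivAt_id (0 : ℝ)).mul_const (2 * (star z ⬝ᵥ ξ).re)).const_add
      (star z ⬝ᵥ z).re).add (((hasDerivAt_id (0 : ℝ)).pow 2).mul_const (star ξ ⬝ᵥ ξ).re)
    convert! this using 1
    simp
  have h2 : HasDerivAt (fun t : ℝ => (star z ⬝ᵥ η).im + t * (star ξ ⬝ᵥ η).im)
      (star ξ ⬝ᵥ η).im 0 := by
    have := ((hasDerivAt_id (0 : ℝ)).mul_const (star ξ ⬝ᵥ η).im).const_add (star z ⬝ᵥ η).im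
    convert! this using 1
    simp
  have h3 := ((hasDerivAt_const (0 : ℝ) (2 : ℝ)).div h1 (by simpa using hN)).mul h2
  rw [lineDeriv, hf]
  refine h3.deriv.trans ?_
  simp
  field_simp
  ring

/-- Antisymmetrize `fderiv_potential_apply`: `Im ⟨ξ, η⟩` is already antisymmetric, so its
coefficient `2` doubles to the `4` of the metric, while the remaining terms pair up. -/
theorem extDeriv_potentialForm {z : Fin (n + 1) → ℂ} (hz : z ≠ 0) (v : Fin 2 → Fin (n + 1) → ℂ) :
    extDeriv potentialForm z v = liftedMetric z (Complex.I • v 0) (v 1) := by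
  rw [extDeriv_apply (differentiableAt_potentialForm hz), Fin.sum_univ_two]
  have h0 : (fun x => potentialForm x (Fin.removeNth 0 v)) = fun x => potential x (v 1) := rfl
  have h1 : (fun x => potentialForm x (Fin.removeNth 1 v)) = fun x => potential x (v 0) := rfl
  have hs : (star (v 1) ⬝ᵥ v 0).im = -(star (v 0) ⬝ᵥ v 1).im := by
    have : star (v 1) ⬝ᵥ v 0 = starRingEnd ℂ (star (v 0) ⬝ᵥ v 1) := by
      rw [← Complex.star_def, Matrix.star_dotProduct]
    rw [this, Complex.conj_im]
  rw [h0, h1, fderiv_potential_apply hz, fderiv_potential_apply hz, liftedMetric_I_smul, hs]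
  simp
  ring

end Potential

/-! ### The canonical one-form as a pullback of the primitive -/

section Pullback

variable {n : ℕ}

/-- The pullback of `potential` under the lifted map. -/
theorem potential_fderiv_liftedMap {a b : Fin (n + 1) → ℝ} (ha : a ≠ 0)
    (h : liftedMetric a b b < 1) (δ : (Fin (n + 1) → ℝ) × (Fin (n + 1) → ℝ)) :
    potential (liftedMap a b)
      (fderiv ℝ (fun x : (Fin (n + 1) → ℝ) × (Fin (n + 1) → ℝ) => liftedMap x.1 x.2) (a, b) δ)
      = liftedMetric a b δ.1 := by
  have hA := (dotProduct_self_pos ha).ne'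
  have hc := (cosCoeff_pos a b).ne'
  have hd := ((contDiffAt_cosCoeff ha h (k := 1)).differentiableAt one_ne_zero).hasFDerivAt
  have hs := ((contDiffAt_orthComponent ha b (k := 1)).differentiableAt one_ne_zero).hasFDerivAt
  have h1 : HasFDerivAt (fun x : (Fin (n + 1) → ℝ) × (Fin (n + 1) → ℝ) => x.1)
    (ContinuousLinearMap.fst ℝ _ _) (a, b) := hasFDerivAt_fst
  set c' := fderiv ℝ (fun x : (Fin (n + 1) → ℝ) × (Fin (n + 1) → ℝ) => cosCoeff x.1 x.2) (a, b)
  set s' := fderiv ℝ (fun x : (Fin (n + 1) → ℝ) × (Fin (n + 1) → ℝ) => orthComponent x.1 x.2)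
    (a, b)
  have hΦ : fderiv ℝ (fun x : (Fin (n + 1) → ℝ) × (Fin (n + 1) → ℝ) => liftedMap x.1 x.2) (a, b) δ
      = complexVec (cosCoeff a b • δ.1 + c' δ • a) (-s' δ) := by
    let L : ((Fin (n + 1) → ℝ) × (Fin (n + 1) → ℝ)) →ₗ[ℝ] (Fin (n + 1) → ℂ) :=
      { toFun := fun x => complexVec x.1 x.2
        map_add' := fun x y => by
          funext k
          simp [complexVec]
          ring
        map_smul' := fun t x => by
          funext k
          simp [complexVec]
          ring }
    have hL : HasFDerivAt (fun x : (Fin (n + 1) → ℝ) × (Fin (n + 1) → ℝ) => liftedMap x.1 x.2) _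
        (a, b) := (LinearMap.toContinuousLinearMap L).hasFDerivAt.comp (a, b)
          ((hd.smul h1).prodMk hs.neg)
    rw [hL.fderiv]
    rfl
  -- Derivative of the identity `a · s = 0`, which holds near `(a, b)`. It replaces an explicit
  -- computation of `ds`.
  have ho : δ.1 ⬝ᵥ orthComponent a b + a ⬝ᵥ s' δ = 0 := by
    have h2 : HasFDerivAt (fun x : (Fin (n + 1) → ℝ) × (Fin (n + 1) → ℝ) =>
        x.1 ⬝ᵥ orthComponent x.1 x.2) (∑ k, _) (a, b) :=
      HasFDerivAt.fun_sum fun k _ => (hasFDerivAt_pi'.1 h1 k).mul (hasFDerivAt_pi'.1 hs k)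
    have h3 : (fun x : (Fin (n + 1) → ℝ) × (Fin (n + 1) → ℝ) => x.1 ⬝ᵥ orthComponent x.1 x.2)
        =ᶠ[𝓝 (a, b)] fun _ => 0 := by
      filter_upwards [(isOpen_ne.preimage continuous_fst).mem_nhds (show (a, b).1 ≠ 0 from ha)]
        with x hx
      exact dotProduct_orthComponent hx _
    have h4 := congrArg (· δ) (h2.unique
      ((hasFDerivAt_const (0 : ℝ) (a, b)).congr_of_eventuallyEq h3))
    simp [Finset.sum_add_distrib] at h4
    simp only [dotProduct]
    rw [← h4, add_comm]
    congr 1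
    exact Finset.sum_congr rfl fun k _ => mul_comm _ _
  have hid := cosCoeff_sq_mul_add ha h.le
  have hoa := dotProduct_orthComponent ha b
  rw [hΦ]
  simp only [potential, smul_apply, imForm_apply, liftedMap,
    star_dotProduct_complexVec, smul_eq_mul]
  simp only [Complex.add_re, Complex.add_im, Complex.ofReal_re, Complex.ofReal_im, Complex.mul_re,
    Complex.mul_im, Complex.I_re, Complex.I_im, mul_zero, mul_one, sub_zero, add_zero, zero_add,
    smul_dotProduct, dotProduct_smul, dotProduct_add, neg_dotProduct, dotProduct_neg, neg_neg,
    smul_eq_mul, dotProduct_comm _ a, hoa]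
  -- The term with `c'` is gone by `a · s = 0`. The denominator becomes `c|a|²`, and its `c` cancels
  -- that of the numerator `2c s·da`.
  have hN : cosCoeff a b * (cosCoeff a b * (a ⬝ᵥ a)) + orthComponent a b ⬝ᵥ orthComponent a b
      = cosCoeff a b * (a ⬝ᵥ a) := by linear_combination hid
  rw [hN, liftedMetric_real]
  have hs1 : orthComponent a b ⬝ᵥ δ.1 = b ⬝ᵥ δ.1 - (a ⬝ᵥ b) / (a ⬝ᵥ a) * (a ⬝ᵥ δ.1) := by
    simp only [orthComponent, sub_dotProduct, smul_dotProduct, smul_eq_mul]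
  have hs2 : a ⬝ᵥ s' δ = -(orthComponent a b ⬝ᵥ δ.1) := by
    rw [dotProduct_comm (orthComponent a b)]
    linarith
  rw [hs2, hs1, dotProduct_comm b a]
  field_simp
  ring

/-- The bundle projection of `τ` is `[A]`, so the canonical form sees only the derivative of `A`;
then the metric is pulled back along `[·]`. -/
theorem canonicalForm_mfderiv {E : Type*} [NormedAddCommGroup E] [NormedSpace ℝ E] {τ : E → TRP n}
    {A B : E → Fin (n + 1) → ℝ} {y : E} (hτ : ∀ x, τ x = tangentOfVec (A x) (B x))
    (hd : MDifferentiableAt 𝓘(ℝ, E) 𝓘(ℝ, Fin n → ℝ).tangent τ y) (hA : DifferentiableAt ℝ A y)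
    (hy : A y ≠ 0) (δ : E) :
    canonicalForm (τ y) (mfderiv 𝓘(ℝ, E) 𝓘(ℝ, Fin n → ℝ).tangent τ y δ)
      = liftedMetric (A y) (B y) (fderiv ℝ A y δ) := by
  obtain rfl : τ = fun x => tangentOfVec (A x) (B x) := funext hτ
  have hp : MDifferentiableAt 𝓘(ℝ, Fin n → ℝ).tangent 𝓘(ℝ, Fin n → ℝ) (fun q : TRP n => q.proj)
      (tangentOfVec (A y) (B y)) :=
    ((Bundle.contMDiff_proj (TangentSpace 𝓘(ℝ, Fin n → ℝ)) (n := 1)).contMDiffAt).mdifferentiableAt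
      one_ne_zero
  have h1 := mfderiv_comp y (I'' := 𝓘(ℝ, Fin n → ℝ)) hp hd
  have h2 := mfderiv_comp y (I' := 𝓘(ℝ, Fin (n + 1) → ℝ)) (mdifferentiableAt_ofVec hy)
    hA.mdifferentiableAt
  have h3 : mfderiv 𝓘(ℝ, Fin n → ℝ).tangent 𝓘(ℝ, Fin n → ℝ) (fun q : TRP n => q.proj)
      (tangentOfVec (A y) (B y)) (mfderiv 𝓘(ℝ, E) 𝓘(ℝ, Fin n → ℝ).tangent
        (fun x => tangentOfVec (A x) (B x)) y δ)
      = mfderiv 𝓘(ℝ, Fin (n + 1) → ℝ) 𝓘(ℝ, Fin n → ℝ) (ofVec ℝ) (A y) (fderiv ℝ A y δ) := by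
    rw [mfderiv_eq_fderiv] at h2
    exact (congrArg (· δ) h1).symm.trans (congrArg (· δ) h2)
  refine Eq.trans ?_ (metric_mfderiv_ofVec hy (B y) (fderiv ℝ A y δ))
  exact congrArg (metric (ofVec ℝ (A y)) (mfderiv 𝓘(ℝ, Fin (n + 1) → ℝ) 𝓘(ℝ, Fin n → ℝ)
    (ofVec ℝ) (A y) (B y))) h3

/-- The section of `ℝⁿ⁺¹ ∖ 0` over the `i`-th affine chart, on tangent vectors. -/
def tangentSection (i : Fin (n + 1)) (x : (Fin n → ℝ) × (Fin n → ℝ)) :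
    (Fin (n + 1) → ℝ) × (Fin (n + 1) → ℝ) :=
  (i.insertNth (1 : ℝ) x.1, i.insertNth (0 : ℝ) x.2)

theorem hasFDerivAt_tangentSection (i : Fin (n + 1)) (x : (Fin n → ℝ) × (Fin n → ℝ)) :
    HasFDerivAt (tangentSection i) ((insertZero i).prodMap (insertZero i)) x :=
  ((hasFDerivAt_insertNth i 1 x.1).comp x hasFDerivAt_fst).prodMk
    ((hasFDerivAt_insertNth i 0 x.2).comp x hasFDerivAt_snd)

theorem contDiff_tangentSection (i : Fin (n + 1)) {k : WithTop ℕ∞} :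
    ContDiff ℝ k (tangentSection i) :=
  ((contDiff_insertNth i 1).comp contDiff_fst).prodMk ((contDiff_insertNth i 0).comp contDiff_snd)

theorem tangentSection_extChartAt (q : TRP n) :
    tangentSection q.proj.chartIdx (extChartAt 𝓘(ℝ, Fin n → ℝ).tangent q q)
      = (q.proj.affineRep, q.proj.tangentLift q.snd) := by
  rw [extChartAt_tangent_self]
  rfl

/-- The local expression of a lift of `discMap`. -/
def localLift (i : Fin (n + 1)) (x : (Fin n → ℝ) × (Fin n → ℝ)) : Fin (n + 1) → ℂ :=
  liftedMap (tangentSection i x).1 (tangentSection i x).2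

theorem contDiffAt_localLift {i : Fin (n + 1)} {x : (Fin n → ℝ) × (Fin n → ℝ)}
    (h : liftedMetric (tangentSection i x).1 (tangentSection i x).2 (tangentSection i x).2 < 1)
    {k : WithTop ℕ∞} : ContDiffAt ℝ k (localLift i) x :=
  (contDiffAt_liftedMap (insertNth_one_ne_zero i x.1) h).comp x
    (contDiff_tangentSection i).contDiffAt

/-- Both sides evaluate to the lifted metric of `b` with the first component of the derivative of
the section: one by `canonicalForm_mfderiv`, the other by `potential_fderiv_liftedMap`. -/
theorem formInChart_canonicalForm (q : TRP n) {x : (Fin n → ℝ) × (Fin n → ℝ)}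
    (h : liftedMetric (tangentSection q.proj.chartIdx x).1 (tangentSection q.proj.chartIdx x).2
      (tangentSection q.proj.chartIdx x).2 < 1) :
    formInChart 𝓘(ℝ, Fin n → ℝ).tangent (fun q : TRP n =>
        ContinuousAlternatingMap.ofSubsingleton ℝ _ ℝ (0 : Fin 1) (canonicalForm q)) q x
      = (potentialForm (localLift q.proj.chartIdx x)).compContinuousLinearMap
        (fderiv ℝ (localLift q.proj.chartIdx) x) := by
  set i := q.proj.chartIdx
  ext v
  have hσ : MDifferentiableAt 𝓘(ℝ, (Fin n → ℝ) × (Fin n → ℝ)) 𝓘(ℝ, Fin n → ℝ).tangent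
      (extChartAt 𝓘(ℝ, Fin n → ℝ).tangent q).symm x := by
    have := contMDiffOn_extChartAt_symm (I := 𝓘(ℝ, Fin n → ℝ).tangent) (n := 1) q
    rw [extChartAt_tangent_target] at this
    exact (contMDiffOn_univ.1 this).contMDiffAt.mdifferentiableAt one_ne_zero
  have h1 := canonicalForm_mfderiv (A := fun x => (tangentSection i x).1)
    (B := fun x => (tangentSection i x).2)
    (τ := (extChartAt 𝓘(ℝ, Fin n → ℝ).tangent q).symm)
    (fun x => extChartAt_tangent_symm_apply q x.1 x.2) hσ
    (hasFDerivAt_tangentSection i x).fst.differentiableAt (insertNth_one_ne_zero i x.1) (v 0)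
  have h2 := (contDiffAt_liftedMap (insertNth_one_ne_zero i x.1) h
    (k := 1)).differentiableAt one_ne_zero
  have h3 := HasFDerivAt.comp x (f := tangentSection i) h2.hasFDerivAt
    (hasFDerivAt_tangentSection i x)
  change HasFDerivAt (localLift i) _ x at h3
  rw [(hasFDerivAt_tangentSection i x).fst.fderiv] at h1
  rw [h3.fderiv]
  exact h1.trans (potential_fderiv_liftedMap (insertNth_one_ne_zero i x.1) h _).symm

/-- Chain rule for the factorization `[·] ∘ localLift ∘ chart`, valid near `q`. -/
theorem mfderiv_discMap {q : TRP n} (hq : q ∈ unitDiscBundle n) :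
    mfderiv 𝓘(ℝ, Fin n → ℝ).tangent 𝓘(ℝ, Fin n → ℂ) discMap q
      = ((mfderiv 𝓘(ℝ, Fin (n + 1) → ℂ) 𝓘(ℝ, Fin n → ℂ) (ofVec ℂ)
            (liftedMap q.proj.affineRep (q.proj.tangentLift q.snd))).comp
          (fderiv ℝ (localLift q.proj.chartIdx) (extChartAt 𝓘(ℝ, Fin n → ℝ).tangent q q))).comp
        (mfderiv 𝓘(ℝ, Fin n → ℝ).tangent 𝓘(ℝ, (Fin n → ℝ) × (Fin n → ℝ))
          (extChartAt 𝓘(ℝ, Fin n → ℝ).tangent q) q) := by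
  set i := q.proj.chartIdx with hi
  have hx0 := tangentSection_extChartAt q
  rw [← hi] at hx0
  have hq' : liftedMetric (tangentSection i (extChartAt 𝓘(ℝ, Fin n → ℝ).tangent q q)).1
      (tangentSection i (extChartAt 𝓘(ℝ, Fin n → ℝ).tangent q q)).2
      (tangentSection i (extChartAt 𝓘(ℝ, Fin n → ℝ).tangent q q)).2 < 1 := by
    rw [hx0]
    exact hq
  have hz : localLift i (extChartAt 𝓘(ℝ, Fin n → ℝ).tangent q q)
      = liftedMap q.proj.affineRep (q.proj.tangentLift q.snd) := by
    rw [localLift, hx0]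
  have hev : discMap =ᶠ[𝓝 q] ofVec ℂ ∘ (localLift i ∘ extChartAt 𝓘(ℝ, Fin n → ℝ).tangent q) := by
    filter_upwards [extChartAt_source_mem_nhds (I := 𝓘(ℝ, Fin n → ℝ).tangent) q] with q' hq'
    have h1 := (extChartAt 𝓘(ℝ, Fin n → ℝ).tangent q).left_inv hq'
    conv_lhs => rw [← h1]
    exact (congrArg discMap (extChartAt_tangent_symm_apply q _ _)).trans
      (discMap_tangentOfVec (insertNth_one_ne_zero i _) _)
  have hext : MDifferentiableAt 𝓘(ℝ, Fin n → ℝ).tangent 𝓘(ℝ, (Fin n → ℝ) × (Fin n → ℝ))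
      (extChartAt 𝓘(ℝ, Fin n → ℝ).tangent q) q :=
    (contMDiffAt_extChartAt (n := 1)).mdifferentiableAt one_ne_zero
  have hl := ((contDiffAt_localLift hq' (k := 1)).differentiableAt one_ne_zero).mdifferentiableAt
  have hne := (sumSqPos_liftedMap q.proj.affineRep_ne_zero
    (liftedMetric_tangentLift_lt_one hq)).ne_zero
  rw [hev.mfderiv_eq]
  have h1 := mfderiv_comp q (I' := 𝓘(ℝ, Fin (n + 1) → ℂ)) (I'' := 𝓘(ℝ, Fin n → ℂ))
    (g := ofVec ℂ) (f := localLift i ∘ extChartAt 𝓘(ℝ, Fin n → ℝ).tangent q)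
    (mdifferentiableAt_ofVec (by rw [Function.comp_apply, hz]; exact hne))
    (hl.comp q hext)
  have h2 := mfderiv_comp q (I' := 𝓘(ℝ, (Fin n → ℝ) × (Fin n → ℝ)))
    (I'' := 𝓘(ℝ, Fin (n + 1) → ℂ)) hl hext
  rw [mfderiv_eq_fderiv] at h2
  -- The target tangent space depends on the base point, so the derivative is viewed in the fixed
  -- model space before the base point is replaced.
  have hD : (show (Fin (n + 1) → ℂ) →L[ℝ] (Fin n → ℂ) from
      mfderiv 𝓘(ℝ, Fin (n + 1) → ℂ) 𝓘(ℝ, Fin n → ℂ) (ofVec ℂ)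
        (localLift i (extChartAt 𝓘(ℝ, Fin n → ℝ).tangent q q)))
      = mfderiv 𝓘(ℝ, Fin (n + 1) → ℂ) 𝓘(ℝ, Fin n → ℂ) (ofVec ℂ)
        (liftedMap q.proj.affineRep (q.proj.tangentLift q.snd)) :=
    congrArg (fun w => (show (Fin (n + 1) → ℂ) →L[ℝ] (Fin n → ℂ) from
      mfderiv 𝓘(ℝ, Fin (n + 1) → ℂ) 𝓘(ℝ, Fin n → ℂ) (ofVec ℂ) w)) hz
  refine h1.trans ((congrArg _ h2).trans ?_)
  exact congrArg (fun D : (Fin (n + 1) → ℂ) →L[ℝ] (Fin n → ℂ) =>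
    (D.comp (fderiv ℝ (localLift i) (extChartAt 𝓘(ℝ, Fin n → ℝ).tangent q q))).comp
    (mfderiv 𝓘(ℝ, Fin n → ℝ).tangent 𝓘(ℝ, (Fin n → ℝ) × (Fin n → ℝ))
          (extChartAt 𝓘(ℝ, Fin n → ℝ).tangent q) q)) hD

theorem fubiniStudyForm_mfderiv_discMap {q : TRP n} (hq : q ∈ unitDiscBundle n)
    (X Y : TangentSpace (𝓘(ℝ, Fin n → ℝ).tangent) q) :
    fubiniStudyForm (discMap q)
        (mfderiv 𝓘(ℝ, Fin n → ℝ).tangent 𝓘(ℝ, Fin n → ℂ) discMap q X)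
        (mfderiv 𝓘(ℝ, Fin n → ℝ).tangent 𝓘(ℝ, Fin n → ℂ) discMap q Y)
      = dCanonicalForm q ![X, Y] := by
  have hne := (sumSqPos_liftedMap q.proj.affineRep_ne_zero
    (liftedMetric_tangentLift_lt_one hq)).ne_zero
  rw [mfderiv_discMap hq]
  refine (fubiniStudyForm_mfderiv_ofVec hne _ _).trans ?_
  set i := q.proj.chartIdx with hi
  set x := extChartAt 𝓘(ℝ, Fin n → ℝ).tangent q q with hx
  have hx0 := tangentSection_extChartAt q
  rw [← hi, ← hx] at hx0
  have hq' : liftedMetric (tangentSection i x).1 (tangentSection i x).2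
      (tangentSection i x).2 < 1 := by
    rw [hx0]
    exact hq
  have hz : localLift i x = liftedMap q.proj.affineRep (q.proj.tangentLift q.snd) := by
    rw [localLift, hx0]
  -- The condition `ρ < 1` is open, so the one-forms agree near `x`, as is needed to compare their
  -- exterior derivatives.
  have hev : formInChart 𝓘(ℝ, Fin n → ℝ).tangent (fun q : TRP n =>
        ContinuousAlternatingMap.ofSubsingleton ℝ _ ℝ (0 : Fin 1) (canonicalForm q)) q
      =ᶠ[𝓝 x] fun x => (potentialForm (localLift i x)).compContinuousLinearMap
        (fderiv ℝ (localLift i) x) := by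
    have hc : ContinuousAt (fun x => liftedMetric (tangentSection i x).1 (tangentSection i x).2
        (tangentSection i x).2) x :=
      ContinuousAt.comp (f := tangentSection i)
        (g := fun y : (Fin (n + 1) → ℝ) × (Fin (n + 1) → ℝ) => liftedMetric y.1 y.2 y.2)
        (contDiffAt_liftedMetric (insertNth_one_ne_zero i x.1) _ (k := 0)).continuousAt
        (contDiff_tangentSection i (k := 0)).continuous.continuousAt
    filter_upwards [hc.eventually_lt continuousAt_const hq'] with y hy
    exact formInChart_canonicalForm q hy
  -- Naturality of `d`: the exterior derivative of the pullback by `localLift` is the pullback of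
  -- `d` of the potential.
  have hE : extDeriv (formInChart 𝓘(ℝ, Fin n → ℝ).tangent (fun q : TRP n =>
        ContinuousAlternatingMap.ofSubsingleton ℝ _ ℝ (0 : Fin 1) (canonicalForm q)) q) x
      = (extDeriv potentialForm (liftedMap q.proj.affineRep (q.proj.tangentLift q.snd))
        ).compContinuousLinearMap (fderiv ℝ (localLift i) x) := by
    rw [hev.extDeriv_eq, extDeriv_pullback (r := 2)
      (differentiableAt_potentialForm (hz ▸ hne)) (contDiffAt_localLift hq') (by simp), hz]
  have hX : dCanonicalForm q ![X, Y]
      = extDeriv potentialForm (liftedMap q.proj.affineRep (q.proj.tangentLift q.snd))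
        (fun k => fderiv ℝ (localLift i) x
          (mfderiv 𝓘(ℝ, Fin n → ℝ).tangent 𝓘(ℝ, (Fin n → ℝ) × (Fin n → ℝ))
            (extChartAt 𝓘(ℝ, Fin n → ℝ).tangent q) q (![X, Y] k))) :=
    DFunLike.congr_fun (congrArg (fun β : ((Fin n → ℝ) × (Fin n → ℝ)) [⋀^Fin 2]→L[ℝ] ℝ =>
      β.compContinuousLinearMap (mfderiv 𝓘(ℝ, Fin n → ℝ).tangent
        𝓘(ℝ, (Fin n → ℝ) × (Fin n → ℝ)) (extChartAt 𝓘(ℝ, Fin n → ℝ).tangent q) q)) hE) ![X, Y]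
  rw [hX, extDeriv_potentialForm hne]
  rfl

end Pullback

end ProjSpace

end

theorem mainTheorem4 (n : ℕ) :
    ∃ F : ProjSpace.TRP n → ProjSpace ℂ n,
      -- a diffeomorphism of the unit disc bundle onto the complement of the quadric
      IsDiffeoOnto (𝓘(ℝ, Fin n → ℝ).tangent) 𝓘(ℝ, Fin n → ℂ) F
        (ProjSpace.unitDiscBundle n) (ProjSpace.quadric n)ᶜ ∧
      -- symplectic
      (∀ q ∈ ProjSpace.unitDiscBundle n,
        ∀ X Y : TangentSpace (𝓘(ℝ, Fin n → ℝ).tangent) q,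
          ProjSpace.fubiniStudyForm (F q)
            (mfderiv (𝓘(ℝ, Fin n → ℝ).tangent) 𝓘(ℝ, Fin n → ℂ) F q X)
            (mfderiv (𝓘(ℝ, Fin n → ℝ).tangent) 𝓘(ℝ, Fin n → ℂ) F q Y)
          = ProjSpace.dCanonicalForm q ![X, Y]) ∧
      -- equivariant
      (∀ A : Matrix.specialOrthogonalGroup (Fin (n + 1)) ℝ, ∀ q ∈ ProjSpace.unitDiscBundle n,
        ProjSpace.rotateTangent A q ∈ ProjSpace.unitDiscBundle n ∧
        F (ProjSpace.rotateTangent A q) = ProjSpace.rotate ℂ A (F q)) ∧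
      -- the explicit form of the map
      (∀ u w : Fin (n + 1) → ℝ, u ⬝ᵥ u = 1 → w ⬝ᵥ w = 1 → u ⬝ᵥ w = 0 →
        ∀ r : ℝ, 0 ≤ r → r < 1 →
          F (tangentMap 𝓘(ℝ, Fin (n + 1) → ℝ) 𝓘(ℝ, Fin n → ℝ) (ProjSpace.ofVec ℝ)
              ⟨u, (r / 2) • w⟩)
          = ProjSpace.ofVec ℂ (fun k =>
              (Real.cos (Real.arcsin r / 2) * u k : ℂ)
                - Complex.I * (Real.sin (Real.arcsin r / 2) * w k))) := by
  exact ⟨ProjSpace.discMap, ProjSpace.isDiffeoOnto_discMap,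
    fun _ hq X Y => ProjSpace.fubiniStudyForm_mfderiv_discMap hq X Y,
    fun A _ hq => ProjSpace.discMap_rotateTangent A hq,
    fun _ _ hu hw huw _ hr hr' => ProjSpace.discMap_tangentOfVec_orthonormal hu hw huw hr hr'⟩
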